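/- Identify $\{\pm1\}$-valued functions with $\{0,1\}$-valued ones. For $n\ge 1$ let $\mathcal L_n$ be the class of halfspaces over the hypercube $\{\pm1\}^n$, i.e. of the functions $f(x)=\mathrm{sign}\bigl(w_0+\sum_{i=1}^n w_ix_i\bigr)$ with $w_0,\dots,w_n\in\mathbb R$, where $\mathrm{sign}(0)=1$. For a probability distribution $\mathcal D$ on a finite set $\mathcal X$, $f,h:\mathcal X\to\{0,1\}$ and a class $\mathcal H$ of such functions, let $\mathrm{dist}_{\mathcal D}(f,h)=\Pr_{x\sim\mathcal D}[f(x)\ne h(x)]$ and $\mathrm{dist}_{\mathcal D}(f,\mathcal H)=\inf_{h\in\mathcal H}\mathrm{dist}_{\mathcal D}(f,h)$. A distribution-free sample $\epsilon$-tester for $\mathcal H$ with sample complexity $m$ is a randomized algorithm that, for every unknown $f:\mathcal X\to\{0,1\}$ and every unknown distribution $\mathcal D$ on $\mathcal X$, receives $m$ independent labelled examples $(x,f(x))$, $x\sim\mathcal D$, outputs $1$ with probability at least $2/3$ if $f\in\mathcal H$, and outputs $0$ with probability at least $2/3$ if $\mathrm{dist}_{\mathcal D}(f,\mathcal H)>\epsilon$.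 Let $m^{\mathrm{test}}_\epsilon(\mathcal H)$ be the minimum such $m$. A $(0,\epsilon)$-tolerant distribution-free adaptive tester for $\mathcal H$ with query complexity $q$ is a randomized algorithm that, for every unknown $f$ and $\mathcal D$, adaptively draws labelled examples $(x,f(x))$ with $x\sim\mathcal D$ and queries $f$ at points of its choice, at most $q$ values of $f$ being sampled or queried in total, outputs $1$ with probability at least $2/3$ if $\mathrm{dist}_{\mathcal D}(f,\mathcal H)=0$, and outputs $0$ with probability at least $2/3$ if $\mathrm{dist}_{\mathcal D}(f,\mathcal H)\ge\epsilon$. Let $q^{\mathrm{tol}}_{0,\epsilon}(\mathcal H)$ be the minimum such $q$. Theorem. There are absolute constants $\epsilon_0>0$ and $c>0$ such that for all $0<\epsilon<\epsilon_0$ and all integers $n\ge2$, $$m^{\mathrm{test}}_\epsilon(\mathcal L_n)\ \ge\ c\,\frac{n}{\log n}\qquad\text{and}\qquad q^{\mathrm{tol}}_{0,\epsilon}(\mathcal L_n)\ \ge\ c\,\frac{n}{\log n}.$$ -/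

import Mathlib

open scoped ENNReal

/-!  # Distribution-free testing of Boolean functions on a finite domain

Labels are `Bool`. On a finite domain `X` every probability distribution is a `PMF X`. -/

namespace PropertyTesting

variable {X : Type*}

/-- `dist_D(f, h)`, the probability over `x ∼ D` that `f x ≠ h x`. -/
noncomputable def distD (D : PMF X) (f h : X → Bool) : ℝ≥0∞ :=
  D.toOuterMeasure {x | f x ≠ h x}

/-- `dist_D(f, H)`, the infimum of `dist_D(f, h)` over `h ∈ H`. -/
noncomputable def distToClass (D : PMF X) (f : X → Bool) (H : Set (X → Bool)) : ℝ≥0∞ :=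
  ⨅ h ∈ H, distD D f h

/-- The law of `m` independent samples from `D`. -/
noncomputable def iid [Fintype X] (D : PMF X) (m : ℕ) : PMF (Fin m → X) :=
  PMF.ofFintype (fun s => ∏ i, D (s i)) (by
    classical
    rw [← Fintype.piFinset_univ, Finset.sum_prod_piFinset Finset.univ (fun (_ : Fin m) x => D x)]
    have h : ∑ x, D x = 1 := by rw [← tsum_fintype (L := .unconditional _)]; exact D.tsum_coe
    simp [h])

/-- A randomized algorithm that sees `m` labelled examples and outputs a bit. Only the law of the
output given the examples matters; `true` means accept, `false` means reject. -/
abbrev SampleAlg (X : Type*) (m : ℕ) := (Fin m → X × Bool) → PMF Bool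

/-- The law of the output of `A` on `m` independent examples `(x, f x)`, `x ∼ D`, over both the
examples and the internal randomness of `A`. -/
noncomputable def SampleAlg.run [Fintype X] {m : ℕ} (A : SampleAlg X m) (f : X → Bool)
    (D : PMF X) : PMF Bool :=
  (iid D m).bind fun s => A fun i => (s i, f (s i))

/-- `A` is a distribution-free (two-sided error) sample `ε`-tester for `H`. -/
def IsSampleTester [Fintype X] (ε : ℝ) (H : Set (X → Bool)) {m : ℕ} (A : SampleAlg X m) : Prop :=
  ∀ (D : PMF X) (f : X → Bool),
    (f ∈ H → 2 / 3 ≤ A.run f D true) ∧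
    (ENNReal.ofReal ε < distToClass D f H → 2 / 3 ≤ A.run f D false)

/-- The minimum number of samples of a distribution-free sample `ε`-tester for `H`
(`⊤` if there is none). -/
noncomputable def mTest [Fintype X] (ε : ℝ) (H : Set (X → Bool)) : ℕ∞ :=
  ⨅ (m : ℕ) (_ : ∃ A : SampleAlg X m, IsSampleTester ε H A), (m : ℕ∞)

/-- A deterministic adaptive algorithm that sees at most `q` values of the input function. It may
stop and output a bit, draw a labelled example `(x, f x)` from the unknown distribution, or
query `f` at a point of its choice; later actions may depend on everything seen before. -/
inductive AdaptiveTree (X : Type*) : ℕ → Type _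
  | output {q : ℕ} (b : Bool) : AdaptiveTree X q
  | sample {q : ℕ} (next : X → Bool → AdaptiveTree X q) : AdaptiveTree X (q + 1)
  | query {q : ℕ} (x : X) (next : Bool → AdaptiveTree X q) : AdaptiveTree X (q + 1)

/-- The law of the output of a deterministic adaptive algorithm on input function `f` and
distribution `D`, over the samples from `D`, which are independent. -/
noncomputable def AdaptiveTree.run (f : X → Bool) (D : PMF X) :
    {q : ℕ} → AdaptiveTree X q → PMF Bool
  | _, .output b => PMF.pure b
  | _, .sample next => D.bind fun x => (next x (f x)).run f D
  | _, .query x next => (next (f x)).run f D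

/-- A randomized adaptive algorithm that samples or queries at most `q` values: a random choice of
a deterministic one. -/
abbrev AdaptiveAlg (X : Type*) (q : ℕ) := PMF (AdaptiveTree X q)

/-- The law of the output of `A` on input function `f` and distribution `D`. -/
noncomputable def AdaptiveAlg.run {q : ℕ} (A : AdaptiveAlg X q) (f : X → Bool) (D : PMF X) :
    PMF Bool :=
  PMF.bind A fun T => T.run f D

/-- `A` is an `(ε₁, ε₂)`-tolerant distribution-free adaptive tester for `H`. -/
def IsTolerantTester (ε₁ ε₂ : ℝ) (H : Set (X → Bool)) {q : ℕ} (A : AdaptiveAlg X q) : Prop :=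
  ∀ (D : PMF X) (f : X → Bool),
    (distToClass D f H ≤ ENNReal.ofReal ε₁ → 2 / 3 ≤ A.run f D true) ∧
    (ENNReal.ofReal ε₂ ≤ distToClass D f H → 2 / 3 ≤ A.run f D false)

/-- The minimum query complexity (number of values sampled or queried) of an `(ε₁, ε₂)`-tolerant
distribution-free adaptive tester for `H` (`⊤` if there is none). -/
noncomputable def qTol (ε₁ ε₂ : ℝ) (H : Set (X → Bool)) : ℕ∞ :=
  ⨅ (q : ℕ) (_ : ∃ A : AdaptiveAlg X q, IsTolerantTester ε₁ ε₂ H A), (q : ℕ∞)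

/-- The hypercube `{±1}^n`; the units of `ℤ` are `1` and `-1`. -/
abbrev Cube (n : ℕ) := Fin n → ℤˣ

/-- Halfspaces over `{±1}^n`: the functions `sign (w₀ + ∑ i, w i * x i)`, with `true` for the
sign `+1` (taken also at `0`) and `false` for the sign `-1`. -/
def halfspaces (n : ℕ) : Set (Cube n → Bool) :=
  {f | ∃ (w₀ : ℝ) (w : Fin n → ℝ), ∀ x : Cube n,
    f x = true ↔ 0 ≤ w₀ + ∑ i, w i * (((x i : ℤˣ) : ℤ) : ℝ)}

end PropertyTesting

open scoped ENNReal

namespace PropertyTesting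

/-! The function is fixed and only the distribution is random. `exists_hard_function` provides `32
n` points `t i` of the cube, a point `t₀` and a labeling `f` with two properties: `f` agrees with
some halfspace on any set of fewer than about `n / 28` of the points together with `t₀`, yet every
halfspace errs on more than `2 n` of the points. The first comes from vectors over `𝔽₂` without
short dependencies, whose `±1` versions are shattered in small groups. The second comes from
Sauer–Shelah counting with VC dimension at most `n + 1`.

Put independent random weights on the points `t i` and the remaining mass on `t₀`.
`exists_matching_moments` gives two weight laws with equal moments up to order `M`, to be scaled by
`1 / (2048 n)`. Under `μ` nearly all weights vanish, so the support is typically small and a tester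
must accept. Under `ν` every weight is at least `1 / (2048 n)`, so every halfspace has error at
least `1 / 1024` and a tester must reject. The bounded means keep the total weight below `1` with
good probability.

For fixed `f` the acceptance probability is a mixture of polynomials in the distribution
(`SamplePoly`). Along the line on which one weight moves, the coefficients are dominated by those of
`(1 + 2X)^q`, so for `q` up to a constant times `n / M` the terms of order above `M` contribute very
little, even when `q` exceeds `M`. Exchanging `μ` for `ν` one point at a time
(`abs_prodSum_samplePoly_sub_le`) costs at most `1 / 10` in total once `M ≥ log n`, whereas
acceptance would have to drop by more than that. This is `exists_untestable`; `M = ⌈log n⌉` gives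
the rate `n / log n`. Sample testers and adaptive testers are treated together through
`IsWeakTester`. -/

/-! ### Measures with matching moments -/

/-- Finite differences: signed weights on the squares of `-M, …, M` that annihilate all
polynomials of degree below `M`, have weight `1` at `0` and weight at most `1` elsewhere. -/
lemma exists_square_weights (M : ℕ) : ∃ w : Fin (2 * M + 1) → ℝ,
    w ⟨M, by omega⟩ = 1 ∧ (∀ i, |w i| ≤ 1) ∧
    ∀ k < M, ∑ i, w i * ((((i : ℕ) : ℝ) - M) ^ 2) ^ k = 0 := by
  have hc : (0 : ℝ) < (2 * M).choose M := by
    exact_mod_cast Nat.choose_pos (by omega)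
  refine ⟨fun i => (-1) ^ (2 * M - (i : ℕ)) * (2 * M).choose i / ((-1) ^ M * (2 * M).choose M),
    ?_, fun i => ?_, fun k hk => ?_⟩
  · have h : 2 * M - M = M := by omega
    simp only [h]
    exact div_self (mul_ne_zero (pow_ne_zero _ (by norm_num)) hc.ne')
  · rw [abs_div, abs_mul, abs_mul, abs_pow, abs_pow]
    simp only [abs_neg, abs_one, one_pow, one_mul, Nat.abs_cast]
    rw [div_le_one hc]
    have := Nat.choose_le_centralBinom i M
    rw [Nat.centralBinom] at this
    exact_mod_cast this
  -- The `2M`-th forward difference at `-M` kills `y ^ (2k)` because `2k < 2M`; its binomial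
  -- coefficients, divided by the central one, are the weights.
  · have h1 := congrFun (fwdDiff_iter_pow_eq_zero_of_lt (R := ℝ) (j := 2 * k) (n := 2 * M)
      (by omega)) (-(M : ℝ))
    rw [fwdDiff_iter_eq_sum_shift, Finset.sum_range] at h1
    rw [← zero_div ((-1 : ℝ) ^ M * (2 * M).choose M)]
    simp only [Pi.zero_apply] at h1
    rw [← h1, Finset.sum_div]
    refine Finset.sum_congr rfl fun i _ => ?_
    simp only [zsmul_eq_mul, nsmul_eq_mul, mul_one]
    push_cast
    rw [← pow_mul]
    ring

/-- Adding a node raises by one the degree up to which signed weights annihilate polynomials. -/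
lemma sum_add_node {ι : Type*} [Fintype ι] (x w : ι → ℝ) {c : ℝ} (hc : ∀ i, x i ≠ c) {K : ℕ}
    (h : ∀ k < K, ∑ i, w i * x i ^ k = 0) :
    ∀ k < K + 1, (-∑ i, w i / (x i - c)) * c ^ k + ∑ i, w i / (x i - c) * x i ^ k = 0 := by
  intro k
  induction k with
  | zero => simp
  | succ k ih =>
    intro hk
    have h1 := ih (by omega)
    have h2 : ∑ i, w i / (x i - c) * x i ^ (k + 1) =
        ∑ i, w i * x i ^ k + c * ∑ i, w i / (x i - c) * x i ^ k := by
      rw [Finset.mul_sum, ← Finset.sum_add_distrib]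
      refine Finset.sum_congr rfl fun i _ => ?_
      have := sub_ne_zero.2 (hc i)
      field_simp
      ring
    rw [h2, h k (by omega), pow_succ]
    linear_combination c * h1

lemma sum_inv_sq_sub_le (M : ℕ) :
    ∑ i ∈ Finset.univ.erase (⟨M, by omega⟩ : Fin (2 * M + 1)), ((((i : ℕ) : ℝ) - M) ^ 2)⁻¹ ≤ 4 := by
  have hone : ∑ i ∈ Finset.range M, (((i : ℝ) + 1) ^ 2)⁻¹ ≤ 2 := by
    have h := sum_Ioo_inv_sq_le (α := ℝ) 0 (M + 1)
    have h2 : Finset.Ioo 0 (M + 1) = Finset.Ico 1 (M + 1) := by ext; simp; omega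
    rw [h2, Finset.sum_Ico_eq_sum_range] at h
    simpa [add_comm] using h
  rw [Finset.sum_erase _ (by simp),
    Fin.sum_univ_eq_sum_range (fun i => (((i : ℝ) - M) ^ 2)⁻¹) (2 * M + 1),
    show 2 * M + 1 = M + (M + 1) by ring, Finset.sum_range_add, Finset.sum_range_succ']
  rw [← Finset.sum_range_reflect]
  have h1 : ∑ j ∈ Finset.range M, (((M - 1 - j : ℕ) - M : ℝ) ^ 2)⁻¹ =
      ∑ i ∈ Finset.range M, (((i : ℝ) + 1) ^ 2)⁻¹ := by
    refine Finset.sum_congr rfl fun j hj => ?_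
    have hj := Finset.mem_range.1 hj
    rw [Nat.sub_sub, Nat.cast_sub (by omega)]
    push_cast
    congr 1
    ring
  rw [h1]
  push_cast
  simp only [add_sub_cancel_left, add_zero, sub_self]
  norm_num
  linarith

/-- A signed measure annihilating polynomials of degree at most `M`, almost all of whose mass
sits at the nodes `0` and `1`. -/
lemma exists_signed_weights {A : ℝ} (hA : 100 ≤ A) {M : ℕ} (hM : 1 ≤ M) :
    ∃ (J : Type) (_ : Fintype J) (_ : DecidableEq J) (x ω : J → ℝ) (j₀ j₁ : J),
      j₀ ≠ j₁ ∧ x j₀ = 0 ∧ x j₁ = 1 ∧ (∀ j, j ≠ j₀ → 1 ≤ x j) ∧ (∀ j, x j ≤ A * M ^ 2) ∧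
      ω j₀ = 1 ∧ (∑ j ∈ (Finset.univ.erase j₀).erase j₁, |ω j| ≤ 24 / A) ∧
      (∑ j ∈ (Finset.univ.erase j₀).erase j₁, |ω j| * x j ≤ 9) ∧
      ∀ k ≤ M, ∑ j, ω j * x j ^ k = 0 := by
  obtain ⟨w, hw0, hw1, hw⟩ := exists_square_weights M
  have hM1 : (1 : ℝ) ≤ M := by exact_mod_cast hM
  set i₀ : Fin (2 * M + 1) := ⟨M, by omega⟩ with hi₀
  set y : Fin (2 * M + 1) → ℝ := fun i => ((i : ℕ) : ℝ) - M with hy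
  have hy0 : y i₀ = 0 := by simp [hy, hi₀]
  have hy1 : ∀ i, i ≠ i₀ → 1 ≤ y i ^ 2 := by
    intro i hi
    have h1 : ((i : ℕ) : ℤ) - M ≠ 0 := by
      intro h
      apply hi
      rw [hi₀, Fin.ext_iff]
      simp only
      omega
    have h2 : (1 : ℤ) ≤ (((i : ℕ) : ℤ) - M) ^ 2 := by
      have := sq_pos_of_ne_zero h1
      omega
    simp only [hy]
    exact_mod_cast h2
  have hyM : ∀ i, y i ^ 2 ≤ (M : ℝ) ^ 2 := by
    intro i
    have h1 : ((i : ℕ) : ℝ) ≤ 2 * M := by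
      have := i.2
      exact_mod_cast (by omega : (i : ℕ) ≤ 2 * M)
    apply sq_le_sq'
    · simp only [hy]; linarith [(Nat.cast_nonneg (i : ℕ) : (0 : ℝ) ≤ (i : ℕ))]
    · simp only [hy]; linarith
  have hysum : ∑ i ∈ Finset.univ.erase i₀, (y i ^ 2)⁻¹ ≤ 4 := sum_inv_sq_sub_le M
  -- Two nodes are added to the dilated squares `A y²`. The node `1` will carry the mass balancing
  -- that at `0`. The node `b` supplies another division by a quantity of order `A y²`, without
  -- which the first moment would be of the order of `∑ |w i|`, which is unbounded in `M`. Starting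
  -- from `b * w`, the two divisions at the node `0`, by `-b` and by `-1`, leave weight exactly `1`.
  set b : ℝ := A / 4 with hb
  have hb25 : 25 ≤ b := by linarith
  have hAb : A = 4 * b := by linarith
  set x : Fin (2 * M + 1) → ℝ := fun i => A * y i ^ 2 with hx
  have hxb : ∀ i, i ≠ i₀ → 3 * (b * y i ^ 2) ≤ x i - b := by
    intro i hi
    simp only [hx, hAb]
    nlinarith [hy1 i hi]
  have hx1 : ∀ i, i ≠ i₀ → 3 * (b * y i ^ 2) ≤ x i - 1 := by
    intro i hi
    linarith [hxb i hi]
  have hx0 : x i₀ = 0 := by simp [hx, hy0]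
  have hbne : ∀ i, x i ≠ b := by
    intro i h
    by_cases hi : i = i₀
    · rw [hi, hx0] at h; linarith
    · nlinarith [hxb i hi, hy1 i hi]
  have hone : ∀ j : Option (Fin (2 * M + 1)), (j.elim b x) ≠ 1 := by
    rintro (_ | i) h
    · simp only [Option.elim] at h; linarith
    · simp only [Option.elim] at h
      by_cases hi : i = i₀
      · rw [hi, hx0] at h; linarith
      · nlinarith [hx1 i hi, hy1 i hi]
  have hm0 : ∀ k < M, ∑ i, (b * w i) * x i ^ k = 0 := by
    intro k hk
    have : ∑ i, (b * w i) * x i ^ k = b * A ^ k * ∑ i, w i * (y i ^ 2) ^ k := by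
      rw [Finset.mul_sum]
      refine Finset.sum_congr rfl fun i _ => ?_
      simp only [hx, mul_pow]
      ring
    rw [this, hw k hk, mul_zero]
  set v : Option (Fin (2 * M + 1)) → ℝ := fun j =>
    j.elim (-∑ i, b * w i / (x i - b)) (fun i => b * w i / (x i - b)) with hv
  have hm1 : ∀ k < M + 1, ∑ j, v j * (j.elim b x) ^ k = 0 := by
    intro k hk
    rw [Fintype.sum_option]
    exact sum_add_node x _ hbne hm0 k hk
  set u : Option (Option (Fin (2 * M + 1))) → ℝ := fun j =>
    j.elim (-∑ j, v j / (j.elim b x - 1)) (fun j => v j / (j.elim b x - 1)) with hu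
  have hm2 : ∀ k < M + 1 + 1, ∑ j, u j * (j.elim 1 (fun j => j.elim b x)) ^ k = 0 := by
    intro k hk
    rw [Fintype.sum_option]
    exact sum_add_node _ _ hone hm1 k hk
  have hvi : ∀ i, i ≠ i₀ → |v (some i)| ≤ (1 / 3) * (y i ^ 2)⁻¹ := by
    intro i hi
    have hyi := hy1 i hi
    have hyn : y i ≠ 0 := by rintro h; rw [h] at hyi; norm_num at hyi
    simp only [hv, Option.elim, abs_div, abs_mul]
    rw [abs_of_pos (show 0 < b by linarith), abs_of_pos (show 0 < x i - b by nlinarith [hxb i hi]),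
      div_le_iff₀ (by nlinarith [hxb i hi])]
    calc b * |w i| ≤ b * 1 := by gcongr; exact hw1 i
      _ = (1 / 3) * (y i ^ 2)⁻¹ * (3 * (b * y i ^ 2)) := by field_simp
      _ ≤ _ := by gcongr; exact hxb i hi
  have hv0 : v (some i₀) = -1 := by
    have hbn : b ≠ 0 := by linarith
    simp only [hv, Option.elim, hx0, hw0]
    field_simp
    norm_num
  have hvn : |v none| ≤ 7 / 3 := by
    have : v none = -∑ i, v (some i) := rfl
    rw [this, abs_neg, ← Finset.add_sum_erase _ _ (Finset.mem_univ i₀), hv0]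
    calc _ ≤ |(-1 : ℝ)| + |∑ i ∈ Finset.univ.erase i₀, v (some i)| := abs_add_le _ _
      _ ≤ 1 + ∑ i ∈ Finset.univ.erase i₀, (1 / 3) * (y i ^ 2)⁻¹ := by
        rw [abs_neg, abs_one]
        gcongr
        exact (Finset.abs_sum_le_sum_abs _ _).trans
          (Finset.sum_le_sum fun i hi => hvi i (Finset.ne_of_mem_erase hi))
      _ ≤ _ := by rw [← Finset.mul_sum]; linarith
  have hui : ∀ i, i ≠ i₀ → |u (some (some i))| ≤ 1 / A * (y i ^ 2)⁻¹ ∧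
      |u (some (some i))| * x i ≤ (y i ^ 2)⁻¹ := by
    intro i hi
    have hyi := hy1 i hi
    have hp : 0 < x i - 1 := by nlinarith [hx1 i hi]
    have h1 : |u (some (some i))| ≤ 1 / 3 * (y i ^ 2)⁻¹ / (3 * (b * y i ^ 2)) := by
      simp only [hu, Option.elim, abs_div]
      rw [abs_of_pos hp]
      gcongr
      · exact hvi i hi
      · exact hx1 i hi
    have h2 : 0 < y i ^ 2 := by linarith
    have h3 : 1 / 3 * (y i ^ 2)⁻¹ / (3 * (b * y i ^ 2)) =
        (4 / 9) * (1 / A * (y i ^ 2)⁻¹ * (y i ^ 2)⁻¹) := by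
      rw [hAb]; field_simp; norm_num
    have h4 : (y i ^ 2)⁻¹ ≤ 1 := inv_le_one_of_one_le₀ hyi
    have h5 : 0 < 1 / A := by rw [hAb]; positivity
    constructor
    · refine h1.trans ?_
      rw [h3]
      have := mul_le_mul_of_nonneg_left h4 (by positivity : 0 ≤ 1 / A * (y i ^ 2)⁻¹)
      nlinarith
    · calc _ ≤ (4 / 9) * (1 / A * (y i ^ 2)⁻¹ * (y i ^ 2)⁻¹) * x i := by
            rw [← h3]
            gcongr
        _ = (4 / 9) * (y i ^ 2)⁻¹ := by
          simp only [hx]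
          have : A ≠ 0 := by linarith
          field_simp
        _ ≤ _ := by nlinarith [inv_pos.2 h2]
  have hub : |u (some none)| ≤ 20 / A ∧ |u (some none)| * b ≤ 5 := by
    have h1 : |u (some none)| ≤ (7 / 3) / (b - 1) := by
      simp only [hu, Option.elim, abs_div]
      rw [abs_of_pos (show 0 < b - 1 by linarith)]
      gcongr
      linarith
    constructor
    · refine h1.trans ?_
      rw [hAb, div_le_div_iff₀ (by linarith) (by linarith)]
      linarith
    · calc _ ≤ (7 / 3) / (b - 1) * b := by gcongr
        _ ≤ _ := by rw [div_mul_eq_mul_div, div_le_iff₀ (by linarith)]; linarith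
  have herase : ∀ g : Option (Option (Fin (2 * M + 1))) → ℝ,
      ∑ j ∈ (Finset.univ.erase (some (some i₀))).erase none, g j =
        g (some none) + ∑ i ∈ Finset.univ.erase i₀, g (some (some i)) := by
    intro g
    have h1 := Finset.add_sum_erase (Finset.univ.erase (some (some i₀))) g
      (a := none) (by simp)
    have h2 := Finset.add_sum_erase Finset.univ g (a := some (some i₀)) (by simp)
    have h3 := Finset.add_sum_erase Finset.univ (fun i => g (some (some i))) (a := i₀) (by simp)
    rw [Fintype.sum_option, Fintype.sum_option] at h2
    linarith
  refine ⟨Option (Option (Fin (2 * M + 1))), inferInstance, inferInstance,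
    fun j => j.elim 1 (fun j => j.elim b x), u, some (some i₀), none, by simp, hx0, rfl, ?_, ?_, ?_,
    ?_, ?_, fun k hk => hm2 k (by omega)⟩
  · rintro (_ | _ | i) hj
    · simp
    · simp only [Option.elim]; linarith
    · have hi : i ≠ i₀ := by rintro rfl; exact hj rfl
      simp only [Option.elim]
      nlinarith [hx1 i hi, hy1 i hi]
  · have hM2 : (1 : ℝ) ≤ (M : ℝ) ^ 2 := one_le_pow₀ hM1
    rintro (_ | _ | i)
    · simp only [Option.elim]; nlinarith
    · simp only [Option.elim]; nlinarith
    · exact mul_le_mul_of_nonneg_left (hyM i) (by linarith)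
  · simp [hu, hv0, hx0]
  · rw [herase]
    calc _ ≤ 20 / A + ∑ i ∈ Finset.univ.erase i₀, 1 / A * (y i ^ 2)⁻¹ :=
        add_le_add hub.1 (Finset.sum_le_sum fun i hi => (hui i (Finset.ne_of_mem_erase hi)).1)
      _ ≤ 20 / A + 1 / A * 4 := by rw [← Finset.mul_sum]; gcongr
      _ = 24 / A := by ring
  · rw [herase]
    calc _ ≤ 5 + ∑ i ∈ Finset.univ.erase i₀, (y i ^ 2)⁻¹ :=
        add_le_add hub.2 (Finset.sum_le_sum fun i hi => (hui i (Finset.ne_of_mem_erase hi)).2)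
      _ ≤ 9 := by linarith

/-- Two probability weights on `{0} ∪ [1, A M²]` with the same moments up to order `M`, one
living almost entirely at `0`, the other not charging `0`. -/
lemma exists_matching_moments {A : ℝ} (hA : 100 ≤ A) {M : ℕ} (hM : 1 ≤ M) :
    ∃ (J : Type) (_ : Fintype J) (x μ ν : J → ℝ) (j₀ : J),
      x j₀ = 0 ∧ (∀ j, j ≠ j₀ → 1 ≤ x j) ∧ (∀ j, x j ≤ A * M ^ 2) ∧
      (∀ j, 0 ≤ μ j) ∧ (∀ j, 0 ≤ ν j) ∧ ∑ j, μ j = 1 ∧ ∑ j, ν j = 1 ∧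
      ν j₀ = 0 ∧ 1 - 24 / A ≤ μ j₀ ∧ ∑ j, μ j * x j ≤ 11 ∧ ∑ j, ν j * x j ≤ 11 ∧
      ∀ k ≤ M, ∑ j, (μ j - ν j) * x j ^ k = 0 := by
  obtain ⟨J, _, _, x, ω, j₀, j₁, hne, hx0, hx1, hx, hxM, hω0, hsum, hmean, hmom⟩ :=
    exists_signed_weights hA hM
  have hsplit : ∀ g : J → ℝ,
      ∑ j, g j = g j₀ + (g j₁ + ∑ j ∈ (Finset.univ.erase j₀).erase j₁, g j) := fun g => by
    rw [Finset.add_sum_erase _ _ (by simp [hne.symm]), Finset.add_sum_erase _ _ (by simp)]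
  set R := (Finset.univ.erase j₀).erase j₁ with hR
  have h24 : 24 / A ≤ 24 / 100 := by gcongr
  have hneg : |∑ j ∈ R, ω j| ≤ 24 / A := (Finset.abs_sum_le_sum_abs _ _).trans hsum
  have h1 : 1 + ω j₁ + ∑ j ∈ R, ω j = 0 := by
    have := hmom 0 (by omega)
    simp only [pow_zero, mul_one] at this
    rw [hsplit, hω0] at this
    linarith
  have hω1 : ω j₁ < 0 := by linarith [(abs_le.1 hneg).1]
  have hω1' : -(1 + 24 / A) ≤ ω j₁ := by linarith [(abs_le.1 hneg).2]
  -- `μ` and `ν` are the positive and negative parts of `ω`. The zeroth moment vanishes, so both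
  -- have the same mass `Z`, which lies between `1` and `1 + 24 / A`.
  set Z := ∑ j, max (ω j) 0 with hZ
  have hZ' : ∑ j, max (-ω j) 0 = Z := by
    have h0 := hmom 0 (by omega)
    simp only [pow_zero, mul_one] at h0
    have : ∀ j, max (ω j) 0 = ω j + max (-ω j) 0 := fun j => by
      rcases le_total (ω j) 0 with h | h
      · rw [max_eq_right h, max_eq_left (by linarith)]; ring
      · rw [max_eq_left h, max_eq_right (by linarith)]; ring
    rw [hZ, Finset.sum_congr rfl fun j _ => this j, Finset.sum_add_distrib, h0, zero_add]
  have hZe : Z = 1 + ∑ j ∈ R, max (ω j) 0 := by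
    rw [hZ, hsplit, hω0, max_eq_right hω1.le]; simp
  have hZ1 : 1 ≤ Z := by
    rw [hZe]
    linarith [Finset.sum_nonneg (s := R) (f := fun j => max (ω j) 0)
      fun j _ => le_max_right (ω j) 0]
  have hZ2 : Z ≤ 1 + 24 / A := by
    rw [hZe]
    gcongr
    refine (Finset.sum_le_sum fun j _ => ?_).trans hsum
    exact max_le (le_abs_self _) (abs_nonneg _)
  have hxn : ∀ j, 0 ≤ x j := fun j => by
    by_cases h : j = j₀
    · rw [h, hx0]
    · linarith [hx j h]
  have hdiv : ∀ t : ℝ, 0 ≤ t → t ≤ 11 → t / Z ≤ 11 := fun t h0 ht =>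
    (div_le_self h0 hZ1).trans ht
  refine ⟨J, inferInstance, x, fun j => max (ω j) 0 / Z, fun j => max (-ω j) 0 / Z, j₀, hx0, hx,
    hxM, fun j => div_nonneg (le_max_right _ _) (by linarith),
    fun j => div_nonneg (le_max_right _ _) (by linarith), ?_, ?_, ?_, ?_, ?_, ?_, ?_⟩
  · rw [← Finset.sum_div, div_self (by linarith)]
  · rw [← Finset.sum_div, hZ', div_self (by linarith)]
  · simp [hω0]
  · have h24p : 0 ≤ 24 / A := le_trans (abs_nonneg _) hneg
    simp only [hω0, max_eq_left zero_le_one]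
    rw [le_div_iff₀ (by linarith)]
    nlinarith
  · have : ∀ j, max (ω j) 0 / Z * x j = max (ω j) 0 * x j / Z := fun j => by ring
    simp only [this]
    rw [← Finset.sum_div]
    apply hdiv _ (Finset.sum_nonneg fun j _ => mul_nonneg (le_max_right _ _) (hxn j))
    rw [hsplit, hx0, max_eq_right hω1.le]
    have : ∑ j ∈ R, max (ω j) 0 * x j ≤ ∑ j ∈ R, |ω j| * x j := Finset.sum_le_sum fun j _ =>
      mul_le_mul_of_nonneg_right (max_le (le_abs_self _) (abs_nonneg _)) (hxn j)
    linarith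
  · have : ∀ j, max (-ω j) 0 / Z * x j = max (-ω j) 0 * x j / Z := fun j => by ring
    simp only [this]
    rw [← Finset.sum_div]
    apply hdiv _ (Finset.sum_nonneg fun j _ => mul_nonneg (le_max_right _ _) (hxn j))
    rw [hsplit, hx0, hx1, max_eq_left (show 0 ≤ -ω j₁ by linarith)]
    have : ∑ j ∈ R, max (-ω j) 0 * x j ≤ ∑ j ∈ R, |ω j| * x j := Finset.sum_le_sum fun j _ =>
      mul_le_mul_of_nonneg_right (max_le (neg_le_abs _) (abs_nonneg _)) (hxn j)
    linarith
  · intro k hk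
    have : ∀ j, (max (ω j) 0 / Z - max (-ω j) 0 / Z) * x j ^ k = ω j * x j ^ k / Z := fun j => by
      rcases le_total (ω j) 0 with h | h
      · rw [max_eq_right h, max_eq_left (show 0 ≤ -ω j by linarith)]; ring
      · rw [max_eq_left h, max_eq_right (show -ω j ≤ 0 by linarith)]; ring
    simp only [this]
    rw [← Finset.sum_div, hmom k hk, zero_div]

/-! ### Polynomials with small coefficients -/

open Polynomial in
lemma coeff_one_add_two_X_mul (Q : ℝ[X]) (k : ℕ) :
    ((1 + 2 * X) * Q).coeff k = Q.coeff k + 2 * (X * Q).coeff k := by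
  rw [add_mul, one_mul, coeff_add, mul_assoc, show (2 : ℝ[X]) = C 2 from rfl, coeff_C_mul]

open Polynomial in
lemma coeff_one_add_two_X_pow_nonneg (q k : ℕ) : 0 ≤ ((1 + 2 * X : ℝ[X]) ^ q).coeff k := by
  induction q generalizing k with
  | zero => rw [pow_zero, coeff_one]; split_ifs <;> norm_num
  | succ q ih =>
    rw [pow_succ', coeff_one_add_two_X_mul]
    have : 0 ≤ (X * (1 + 2 * X : ℝ[X]) ^ q).coeff k := by
      cases k with
      | zero => simp
      | succ k => rw [coeff_X_mul]; exact ih k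
    linarith [ih k]

open Polynomial in
/-- A signed measure with vanishing moments up to order `M` nearly annihilates polynomials with
small coefficients. -/
lemma abs_sum_mul_eval_le {q : ℕ} {J : Type*} [Fintype J] {x d : J → ℝ} {r ρ : ℝ} {M : ℕ}
    (hx : ∀ j, 0 ≤ x j) (hxr : ∀ j, x j ≤ r) (hr : 0 < r) (hρ : r ≤ ρ)
    (hd : ∑ j, |d j| ≤ 2) (hmom : ∀ k ≤ M, ∑ j, d j * x j ^ k = 0) {P : ℝ[X]}
    (hP : ∀ k, |P.coeff k| ≤ ((1 + 2 * X : ℝ[X]) ^ q).coeff k) :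
    |∑ j, d j * P.eval (x j)| ≤ 2 * (r / ρ) ^ (M + 1) * (1 + 2 * ρ) ^ q := by
  have hρ0 : 0 < ρ := hr.trans_le hρ
  set Q := (1 + 2 * X : ℝ[X]) ^ q with hQ
  set n := max P.natDegree Q.natDegree + 1 with hn
  have h1 : ∑ j, d j * P.eval (x j) =
      ∑ k ∈ Finset.range n, P.coeff k * ∑ j, d j * x j ^ k := by
    simp_rw [eval_eq_sum_range' (show P.natDegree < n by omega), Finset.mul_sum]
    rw [Finset.sum_comm]
    refine Finset.sum_congr rfl fun k _ => Finset.sum_congr rfl fun j _ => by ring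
  have h2 : (1 + 2 * ρ) ^ q = ∑ k ∈ Finset.range n, Q.coeff k * ρ ^ k := by
    rw [← eval_eq_sum_range' (show Q.natDegree < n by omega)]
    simp only [hQ, eval_pow, eval_add, eval_one, eval_mul, eval_X, eval_ofNat]
  rw [h1, h2, Finset.mul_sum]
  refine (Finset.abs_sum_le_sum_abs _ _).trans (Finset.sum_le_sum fun k _ => ?_)
  have hQk : 0 ≤ Q.coeff k := coeff_one_add_two_X_pow_nonneg q k
  have hrρ : 0 ≤ r / ρ := by positivity
  by_cases hk : k ≤ M
  · rw [hmom k hk, mul_zero, abs_zero]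
    positivity
  · rw [abs_mul]
    have h3 : |∑ j, d j * x j ^ k| ≤ 2 * r ^ k := by
      calc _ ≤ ∑ j, |d j| * r ^ k := by
            refine (Finset.abs_sum_le_sum_abs _ _).trans (Finset.sum_le_sum fun j _ => ?_)
            rw [abs_mul, abs_of_nonneg (pow_nonneg (hx j) k)]
            exact mul_le_mul_of_nonneg_left (pow_le_pow_left₀ (hx j) (hxr j) k) (abs_nonneg _)
        _ ≤ _ := by rw [← Finset.sum_mul]; gcongr
    -- Orders up to `M` vanish exactly. Beyond them, evaluating the majorant at the larger radius
    -- `ρ` gains the factor `(r / ρ) ^ (M + 1)`, whatever the degree of `P`.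
    have h4 : r ^ k ≤ (r / ρ) ^ (M + 1) * ρ ^ k := by
      have h5 : (r / ρ) ^ k ≤ (r / ρ) ^ (M + 1) :=
        pow_le_pow_of_le_one hrρ ((div_le_one hρ0).2 hρ) (by omega)
      calc r ^ k = (r / ρ) ^ k * ρ ^ k := by rw [← mul_pow, div_mul_cancel₀ _ hρ0.ne']
        _ ≤ _ := by gcongr
    calc _ ≤ Q.coeff k * (2 * r ^ k) := mul_le_mul (hP k) h3 (abs_nonneg _) hQk
      _ ≤ Q.coeff k * (2 * ((r / ρ) ^ (M + 1) * ρ ^ k)) := by gcongr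
      _ = _ := by ring

/-! ### Acceptance probabilities as polynomials in the distribution -/

/-- Functions of a weight `p` on `X` of the shape of the acceptance probability of an algorithm
that draws at most `q` samples from `p`. -/
inductive SamplePoly {X : Type*} [Fintype X] : ℕ → ((X → ℝ) → ℝ) → Prop
  | const (q : ℕ) {c : ℝ} (h₀ : 0 ≤ c) (h₁ : c ≤ 1) : SamplePoly q fun _ => c
  | succ {q : ℕ} {Φ : (X → ℝ) → ℝ} (h : SamplePoly q Φ) : SamplePoly (q + 1) Φ
  | sample {q : ℕ} (G : X → (X → ℝ) → ℝ) (h : ∀ x, SamplePoly q (G x)) :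
      SamplePoly (q + 1) fun p => ∑ x, p x * G x p

section SamplePoly

variable {α : Type*} [Fintype α] {q : ℕ} {Φ : (α → ℝ) → ℝ}

lemma SamplePoly.mem_Icc (h : SamplePoly q Φ) {p : α → ℝ} (hp : ∀ x, 0 ≤ p x)
    (hp1 : ∑ x, p x = 1) : 0 ≤ Φ p ∧ Φ p ≤ 1 := by
  induction h with
  | const q h₀ h₁ => exact ⟨h₀, h₁⟩
  | succ _ ih => exact ih
  | sample G _ ih =>
    refine ⟨Finset.sum_nonneg fun x _ => mul_nonneg (hp x) (ih x).1, ?_⟩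
    calc _ ≤ ∑ x, p x * 1 := Finset.sum_le_sum fun x _ =>
          mul_le_mul_of_nonneg_left (ih x).2 (hp x)
      _ = 1 := by simp [hp1]

open Polynomial in
/-- Along a line, the polynomial is majorized coefficientwise by `(1 + 2X)^q`. -/
lemma SamplePoly.exists_majorant (h : SamplePoly q Φ) {r σ : α → ℝ} (hr : ∀ x, 0 ≤ r x)
    (hr1 : ∑ x, r x = 1) (hσ : ∑ x, |σ x| ≤ 2) :
    ∃ P : ℝ[X], (∀ y, Φ (fun x => r x + y * σ x) = P.eval y) ∧
      ∀ k, |P.coeff k| ≤ ((1 + 2 * X : ℝ[X]) ^ q).coeff k := by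
  have hstep : ∀ q k, ((1 + 2 * X : ℝ[X]) ^ q).coeff k ≤ ((1 + 2 * X : ℝ[X]) ^ (q + 1)).coeff k := by
    intro q k
    rw [pow_succ', coeff_one_add_two_X_mul]
    have : 0 ≤ (X * (1 + 2 * X : ℝ[X]) ^ q).coeff k := by
      cases k with
      | zero => simp
      | succ k => rw [coeff_X_mul]; exact coeff_one_add_two_X_pow_nonneg q k
    linarith
  induction h with
  | @const q c h₀ h₁ =>
    refine ⟨C c, fun y => by simp, fun k => ?_⟩
    have h : ((1 : ℝ[X])).coeff k ≤ ((1 + 2 * X : ℝ[X]) ^ q).coeff k := by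
      induction q with
      | zero => simp
      | succ q ih => exact ih.trans (hstep q k)
    refine le_trans ?_ h
    rw [coeff_C, coeff_one]
    split_ifs
    · rw [abs_of_nonneg h₀]; exact h₁
    · simp
  | succ _ ih =>
    obtain ⟨P, hP, hPc⟩ := ih
    exact ⟨P, hP, fun k => (hPc k).trans (hstep _ k)⟩
  | @sample q G _ ih =>
    choose P hP hPc using ih
    -- Drawing a sample averages the `P x` against linear forms whose coefficients have total
    -- absolute size at most `1` and `2`, so the majorant is multiplied by `1 + 2X`.
    refine ⟨∑ x, (C (r x) + C (σ x) * X) * P x, fun y => ?_, fun k => ?_⟩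
    · rw [eval_finsetSum]
      refine Finset.sum_congr rfl fun x _ => ?_
      rw [hP x y, eval_mul, eval_add, eval_mul, eval_C, eval_C, eval_X]
      ring
    · rw [finsetSum_coeff, pow_succ', coeff_one_add_two_X_mul]
      set Q := (1 + 2 * X : ℝ[X]) ^ q
      have hX : ∀ x, |(X * P x).coeff k| ≤ (X * Q).coeff k := fun x => by
        cases k with
        | zero => simp
        | succ k => rw [coeff_X_mul, coeff_X_mul]; exact hPc x k
      have hXQ : 0 ≤ (X * Q).coeff k := by
        cases k with
        | zero => simp
        | succ k => rw [coeff_X_mul]; exact coeff_one_add_two_X_pow_nonneg q k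
      calc |∑ x, ((C (r x) + C (σ x) * X) * P x).coeff k|
          ≤ ∑ x, |((C (r x) + C (σ x) * X) * P x).coeff k| := Finset.abs_sum_le_sum_abs _ _
        _ ≤ ∑ x, (r x * Q.coeff k + |σ x| * (X * Q).coeff k) := by
          refine Finset.sum_le_sum fun x _ => ?_
          rw [add_mul, coeff_add, mul_assoc, coeff_C_mul, coeff_C_mul]
          refine (abs_add_le _ _).trans ?_
          rw [abs_mul, abs_mul, abs_of_nonneg (hr x)]
          exact add_le_add (mul_le_mul_of_nonneg_left (hPc x k) (hr x))
            (mul_le_mul_of_nonneg_left (hX x) (abs_nonneg _))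
        _ = Q.coeff k + (∑ x, |σ x|) * (X * Q).coeff k := by
          rw [Finset.sum_add_distrib, ← Finset.sum_mul, ← Finset.sum_mul, hr1, one_mul]
        _ ≤ Q.coeff k + 2 * (X * Q).coeff k := by gcongr

end SamplePoly

/-! ### Product measures and the hybrid argument -/

section Product

variable {ι J : Type*} [Fintype ι] [DecidableEq ι] [Fintype J]

/-- The integral of `F` against the product of the weights `κ i`. -/
def prodSum (κ : ι → J → ℝ) (F : (ι → J) → ℝ) : ℝ := ∑ u : ι → J, (∏ i, κ i (u i)) * F u

lemma prodSum_mono {κ : ι → J → ℝ} (hκ : ∀ i j, 0 ≤ κ i j) {F G : (ι → J) → ℝ}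
    (h : ∀ u, F u ≤ G u) : prodSum κ F ≤ prodSum κ G :=
  Finset.sum_le_sum fun u _ =>
    mul_le_mul_of_nonneg_left (h u) (Finset.prod_nonneg fun i _ => hκ i _)

lemma abs_prodSum_le {κ : ι → J → ℝ} (hκ : ∀ i j, 0 ≤ κ i j) {F G : (ι → J) → ℝ}
    (h : ∀ u, |F u| ≤ G u) : |prodSum κ F| ≤ prodSum κ G := by
  refine (Finset.abs_sum_le_sum_abs _ _).trans (Finset.sum_le_sum fun u _ => ?_)
  have h0 : 0 ≤ ∏ i, κ i (u i) := Finset.prod_nonneg fun i _ => hκ i _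
  rw [abs_mul, abs_of_nonneg h0]
  exact mul_le_mul_of_nonneg_left (h u) h0

lemma prodSum_add (κ : ι → J → ℝ) (F G : (ι → J) → ℝ) :
    prodSum κ (fun u => F u + G u) = prodSum κ F + prodSum κ G := by
  simp [prodSum, mul_add, Finset.sum_add_distrib]

lemma prodSum_const_mul (κ : ι → J → ℝ) (c : ℝ) (F : (ι → J) → ℝ) :
    prodSum κ (fun u => c * F u) = c * prodSum κ F := by
  simp only [prodSum, Finset.mul_sum]
  exact Finset.sum_congr rfl fun u _ => by ring

lemma prodSum_prod (κ : ι → J → ℝ) (g : ι → J → ℝ) :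
    prodSum κ (fun u => ∏ i, g i (u i)) = ∏ i, ∑ j, κ i j * g i j := by
  rw [Finset.prod_univ_sum, Fintype.piFinset_univ]
  exact Finset.sum_congr rfl fun u _ => Finset.prod_mul_distrib.symm

lemma prodSum_one {κ : ι → J → ℝ} (hκ : ∀ i, ∑ j, κ i j = 1) : prodSum κ (fun _ => 1) = 1 := by
  have := prodSum_prod κ (fun _ _ => 1)
  simpa [hκ] using this

/-- This is resampling of one coordinate. The old value integrates out because `κ i` has mass one,
and exchanging the old value with the fresh one is an involution of the pairs. -/
lemma prodSum_update {κ : ι → J → ℝ} {i : ι} (hκ : ∑ j, κ i j = 1) (α : J → ℝ)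
    (F : (ι → J) → ℝ) :
    prodSum (Function.update κ i α) F =
      prodSum κ fun u => ∑ j, α j * F (Function.update u i j) := by
  have hinv : Function.Involutive
      (fun z : (ι → J) × J => (Function.update z.1 i z.2, z.1 i)) := fun z => by simp
  have hprod : ∀ (κ : ι → J → ℝ) (u : ι → J),
      ∏ k, κ k (u k) = κ i (u i) * ∏ k ∈ Finset.univ.erase i, κ k (u k) := fun κ u =>
    (Finset.mul_prod_erase _ (fun k => κ k (u k)) (Finset.mem_univ i)).symm
  have h1 : (prodSum κ fun u => ∑ j, α j * F (Function.update u i j)) =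
      ∑ z : (ι → J) × J, (∏ k, κ k (z.1 k)) * (α z.2 * F (Function.update z.1 i z.2)) := by
    rw [Fintype.sum_prod_type]
    simp only [prodSum, Finset.mul_sum]
  rw [h1, ← Equiv.sum_comp hinv.toPerm, Fintype.sum_prod_type]
  refine Finset.sum_congr rfl fun u _ => ?_
  have h2 : ∀ j, ∏ k, κ k (Function.update u i j k) =
      κ i j * ∏ k ∈ Finset.univ.erase i, κ k (u k) := fun j => by
    rw [hprod, Function.update_self]
    congr 1
    exact Finset.prod_congr rfl fun k hk => by
      rw [Function.update_of_ne (Finset.ne_of_mem_erase hk)]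
  have h3 : ∏ k, Function.update κ i α k (u k) =
      α (u i) * ∏ k ∈ Finset.univ.erase i, κ k (u k) := by
    rw [hprod, Function.update_self]
    congr 1
    exact Finset.prod_congr rfl fun k hk => by
      rw [Function.update_of_ne (Finset.ne_of_mem_erase hk)]
  simp only [Function.Involutive.coe_toPerm, Function.update_idem, Function.update_eq_self,
    h2, h3]
  rw [← Finset.sum_mul, ← Finset.sum_mul, hκ, one_mul]
  ring

/-- Replacing `μ` by `ν` one coordinate at a time. -/
lemma abs_prodSum_sub_le {μ ν : J → ℝ} (hμ : ∀ j, 0 ≤ μ j) (hν : ∀ j, 0 ≤ ν j)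
    (hν1 : ∑ j, ν j = 1) (F G : (ι → J) → ℝ) {C : ℝ}
    (hF : ∀ i u, |∑ j, (μ j - ν j) * F (Function.update u i j)| ≤ G u)
    (hG : ∀ κ : ι → J → ℝ, (∀ i, κ i = μ ∨ κ i = ν) → prodSum κ G ≤ C) :
    |prodSum (fun _ => μ) F - prodSum (fun _ => ν) F| ≤ Fintype.card ι * C := by
  have key : ∀ s : Finset ι,
      |prodSum (fun i => if i ∈ s then μ else ν) F - prodSum (fun _ => ν) F| ≤ s.card * C := by
    intro s
    induction s using Finset.induction_on with
    | empty => simp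
    | insert i s hi ih =>
      set κ : ι → J → ℝ := fun i => if i ∈ s then μ else ν with hκ
      have hκ' : ∀ i, κ i = μ ∨ κ i = ν := fun k => by
        by_cases h : k ∈ s <;> simp [hκ, h]
      have hκ0 : ∀ i j, 0 ≤ κ i j := fun k j => by
        rcases hκ' k with h | h <;> rw [h]
        exacts [hμ j, hν j]
      have hi' : κ i = ν := by simp [hκ, hi]
      have h1 : (fun k => if k ∈ insert i s then μ else ν) = Function.update κ i μ := by
        ext k j
        by_cases hk : k = i
        · subst hk; simp
        · simp [hk, hκ]
      have h2 : κ = Function.update κ i ν := by rw [← hi', Function.update_eq_self]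
      have h3 : |prodSum (Function.update κ i μ) F - prodSum κ F| ≤ C := by
        have hs : ∑ j, κ i j = 1 := by rw [hi']; exact hν1
        nth_rewrite 2 [h2]
        rw [prodSum_update hs, prodSum_update hs]
        have h4 : (prodSum κ fun u => ∑ j, μ j * F (Function.update u i j)) -
            (prodSum κ fun u => ∑ j, ν j * F (Function.update u i j)) =
            prodSum κ fun u => ∑ j, (μ j - ν j) * F (Function.update u i j) := by
          simp only [prodSum, ← Finset.sum_sub_distrib, ← mul_sub, sub_mul]
        rw [h4]
        exact (abs_prodSum_le hκ0 (hF i)).trans (hG κ hκ')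
      rw [h1, Finset.card_insert_of_notMem hi]
      push_cast
      calc _ ≤ |prodSum (Function.update κ i μ) F - prodSum κ F| +
            |prodSum κ F - prodSum (fun _ => ν) F| := abs_sub_le _ _ _
        _ ≤ _ := by linarith
  simpa using key Finset.univ

/-- Exponentials of independent sums factorize. This is the Chernoff ingredient controlling the
event that the total weight exceeds `1`. -/
lemma prodSum_exp_le {κ : ι → J → ℝ} (hκ : ∀ i j, 0 ≤ κ i j) {x : J → ℝ} {θ E : ℝ}
    (hE : ∀ i, ∑ j, κ i j * Real.exp (θ * x j) ≤ E) :
    prodSum κ (fun u => Real.exp (θ * ∑ i, x (u i))) ≤ E ^ Fintype.card ι := by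
  have h := prodSum_prod κ (fun _ j => Real.exp (θ * x j))
  have h2 : (fun u : ι → J => ∏ i, Real.exp (θ * x (u i))) =
      fun u => Real.exp (θ * ∑ i, x (u i)) := by
    ext u
    rw [Finset.mul_sum, Real.exp_sum]
  rw [← h2, h, ← Finset.card_univ, ← Finset.prod_const]
  exact Finset.prod_le_prod
    (fun i _ => Finset.sum_nonneg fun j _ => mul_nonneg (hκ i j) (Real.exp_pos _).le)
    fun i _ => hE i

lemma prodSum_sum {μ : J → ℝ} (hμ1 : ∑ j, μ j = 1) (g : J → ℝ) :
    prodSum (fun _ : ι => μ) (fun u => ∑ i, g (u i)) = Fintype.card ι * ∑ j, μ j * g j := by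
  have h : ∀ i, prodSum (fun _ : ι => μ) (fun u => g (u i)) = ∑ j, μ j * g j := fun i => by
    have h1 := prodSum_prod (fun _ : ι => μ) (fun k j => if k = i then g j else 1)
    have h2 : (fun u : ι → J => ∏ k, if k = i then g (u k) else 1) = fun u => g (u i) := by
      ext u; simp
    rw [h2] at h1
    rw [h1, Finset.prod_eq_single i]
    · simp
    · intro k _ hk; simp [hk, hμ1]
    · simp
  calc _ = ∑ i, prodSum (fun _ : ι => μ) (fun u => g (u i)) := by
        simp only [prodSum, Finset.mul_sum]
        exact Finset.sum_comm
    _ = _ := by simp [h]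

end Product

section Hybrid

variable {X ι J : Type*} [Fintype X] [DecidableEq X] [Fintype ι] [DecidableEq ι] [Fintype J]

/-- The weight on `X` that puts mass `w i` on the point `t i` and the remaining mass on `t₀`. -/
def pointWeight (t : ι → X) (t₀ : X) (w : ι → ℝ) (x : X) : ℝ :=
  (∑ i, if t i = x then w i else 0) + if t₀ = x then 1 - ∑ i, w i else 0

omit [DecidableEq ι] in
lemma sum_pointWeight (t : ι → X) (t₀ : X) (w : ι → ℝ) : ∑ x, pointWeight t t₀ w x = 1 := by
  simp only [pointWeight, Finset.sum_add_distrib]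
  rw [Finset.sum_comm]
  simp

omit [Fintype X] [DecidableEq ι] in
lemma pointWeight_nonneg (t : ι → X) (t₀ : X) {w : ι → ℝ} (hw : ∀ i, 0 ≤ w i)
    (hw1 : ∑ i, w i ≤ 1) (x : X) : 0 ≤ pointWeight t t₀ w x := by
  refine add_nonneg (Finset.sum_nonneg fun i _ => ?_) ?_
  · split_ifs; exacts [hw i, le_rfl]
  · split_ifs; exacts [by linarith, le_rfl]

-- Changing one weight moves mass between `t i` and `t₀`, that is, along a line whose direction has
-- `ℓ¹` norm at most `2`: the setting of `SamplePoly.exists_majorant`.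
omit [Fintype X] in
lemma pointWeight_update (t : ι → X) (t₀ : X) (w : ι → ℝ) (i : ι) (y : ℝ) :
    pointWeight t t₀ (Function.update w i y) = fun x => pointWeight t t₀ (Function.update w i 0) x +
      y * ((if t i = x then 1 else 0) - if t₀ = x then 1 else 0) := by
  ext x
  simp only [pointWeight]
  have h : ∀ y, ∑ k, Function.update w i y k = y + ∑ k ∈ Finset.univ.erase i, w k := fun y => by
    rw [← Finset.add_sum_erase _ _ (Finset.mem_univ i), Function.update_self]
    congr 1
    exact Finset.sum_congr rfl fun k hk => by
      rw [Function.update_of_ne (Finset.ne_of_mem_erase hk)]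
  have h' : ∀ y, (∑ k, if t k = x then Function.update w i y k else 0) =
      (if t i = x then y else 0) + ∑ k ∈ Finset.univ.erase i, if t k = x then w k else 0 :=
    fun y => by
      rw [← Finset.add_sum_erase _ _ (Finset.mem_univ i), Function.update_self]
      congr 1
      exact Finset.sum_congr rfl fun k hk => by
        rw [Function.update_of_ne (Finset.ne_of_mem_erase hk)]
  rw [h y, h 0, h' y, h' 0]
  split_ifs <;> ring

/-- An algorithm with few samples cannot tell apart distributions with random weights drawn from
`μ` and from `ν` if these have the same first moments. -/
lemma abs_prodSum_samplePoly_sub_le {q : ℕ} {Φ : (X → ℝ) → ℝ} (hΦ : SamplePoly q Φ) (t : ι → X)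
    (t₀ : X) {x μ ν : J → ℝ} {r ρ θ E : ℝ} {M : ℕ}
    (hx : ∀ j, 0 ≤ x j) (hxr : ∀ j, x j ≤ r) (hr : 0 < r) (hρ : r ≤ ρ) (hθ : 0 ≤ θ)
    (hμ : ∀ j, 0 ≤ μ j) (hν : ∀ j, 0 ≤ ν j) (hμ1 : ∑ j, μ j = 1) (hν1 : ∑ j, ν j = 1)
    (hmom : ∀ k ≤ M, ∑ j, (μ j - ν j) * x j ^ k = 0)
    (hμE : ∑ j, μ j * Real.exp (θ * x j) ≤ E) (hνE : ∑ j, ν j * Real.exp (θ * x j) ≤ E) :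
    |(prodSum (fun _ : ι => μ) fun u =>
        if ∑ i, x (u i) ≤ 1 then Φ (pointWeight t t₀ fun i => x (u i)) else 0) -
      (prodSum (fun _ : ι => ν) fun u =>
        if ∑ i, x (u i) ≤ 1 then Φ (pointWeight t t₀ fun i => x (u i)) else 0)| ≤
    Fintype.card ι * (2 * (r / ρ) ^ (M + 1) * (1 + 2 * ρ) ^ q +
      2 * Real.exp (θ * (r - 1)) * E ^ Fintype.card ι) := by
  have hd : ∑ j, |μ j - ν j| ≤ 2 := by
    calc _ ≤ ∑ j, (μ j + ν j) := Finset.sum_le_sum fun j _ => by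
          rw [abs_le]; constructor <;> linarith [hμ j, hν j]
      _ = 2 := by rw [Finset.sum_add_distrib, hμ1, hν1]; norm_num
  set δ := 2 * (r / ρ) ^ (M + 1) * (1 + 2 * ρ) ^ q with hδ
  have hδ0 : 0 ≤ δ := by
    have : 0 < ρ := hr.trans_le hρ
    positivity
  refine abs_prodSum_sub_le hμ hν hν1 _
    (fun u => δ + 2 * Real.exp (θ * (r - 1)) * Real.exp (θ * ∑ i, x (u i))) ?_ ?_
  · intro i u
    have hup : ∀ j, (fun k => x (Function.update u i j k)) =
        Function.update (fun k => x (u k)) i (x j) := fun j => by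
      ext k
      by_cases hk : k = i
      · subst hk; simp
      · simp [hk]
    have hsum : ∀ y, ∑ k, Function.update (fun k => x (u k)) i y k =
        y + ∑ k ∈ Finset.univ.erase i, x (u k) := fun y => by
      rw [← Finset.add_sum_erase _ _ (Finset.mem_univ i), Function.update_self]
      congr 1
      exact Finset.sum_congr rfl fun k hk => by
        rw [Function.update_of_ne (Finset.ne_of_mem_erase hk)]
    have hsum' : ∀ j, ∑ k, x (Function.update u i j k) =
        x j + ∑ k ∈ Finset.univ.erase i, x (u k) := fun j => by
      rw [← hsum, ← hup]
    have hnn : ∀ k, 0 ≤ x (u k) := fun k => hx _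
    -- Either the cutoff is inactive for every value of coordinate `i`, and the polynomial estimate
    -- applies, or the total weight is nearly `1`. In the second case the trivial bound `2` is
    -- absorbed by the exponential term of the majorant.
    by_cases hS : r + ∑ k ∈ Finset.univ.erase i, x (u k) ≤ 1
    · have h1 : ∀ j, (if ∑ k, x (Function.update u i j k) ≤ 1 then
          Φ (pointWeight t t₀ fun k => x (Function.update u i j k)) else 0) =
          Φ (fun z => pointWeight t t₀ (Function.update (fun k => x (u k)) i 0) z +
            x j * ((if t i = z then 1 else 0) - if t₀ = z then 1 else 0)) := fun j => by
        rw [if_pos (by rw [hsum']; linarith [hxr j]), hup, pointWeight_update]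
      simp only [h1]
      obtain ⟨P, hP, hPc⟩ := hΦ.exists_majorant
        (r := pointWeight t t₀ (Function.update (fun k => x (u k)) i 0))
        (σ := fun z => (if t i = z then 1 else 0) - if t₀ = z then 1 else 0)
        (pointWeight_nonneg t t₀
          (fun k => by
            by_cases hk : k = i
            · subst hk; simp
            · simp [hk, hnn k])
          (by rw [hsum]; linarith))
        (sum_pointWeight _ _ _)
        (by
          calc _ ≤ ∑ z, ((if t i = z then (1 : ℝ) else 0) + if t₀ = z then 1 else 0) :=
                Finset.sum_le_sum fun z _ => by split_ifs <;> norm_num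
            _ = 2 := by rw [Finset.sum_add_distrib]; simp; norm_num)
      simp only [hP]
      have := abs_sum_mul_eval_le hx hxr hr hρ hd hmom hPc
      have h3 : 0 ≤ 2 * Real.exp (θ * (r - 1)) * Real.exp (θ * ∑ i, x (u i)) := by positivity
      linarith
    · have hF : ∀ u : ι → J, |if ∑ i, x (u i) ≤ 1 then
          Φ (pointWeight t t₀ fun i => x (u i)) else 0| ≤ 1 := fun u => by
        split_ifs with h
        · have := hΦ.mem_Icc (pointWeight_nonneg t t₀ (fun i => hx (u i)) h)
            (sum_pointWeight t t₀ _)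
          rw [abs_of_nonneg this.1]; exact this.2
        · simp
      have h1 : |∑ j, (μ j - ν j) * (if ∑ k, x (Function.update u i j k) ≤ 1 then
          Φ (pointWeight t t₀ fun k => x (Function.update u i j k)) else 0)| ≤ 2 := by
        refine (Finset.abs_sum_le_sum_abs _ _).trans (le_trans (Finset.sum_le_sum fun j _ => ?_) hd)
        rw [abs_mul]
        exact mul_le_of_le_one_right (abs_nonneg _) (hF _)
      have h2 : 1 ≤ Real.exp (θ * (r - 1)) * Real.exp (θ * ∑ i, x (u i)) := by
        rw [← Real.exp_add, ← mul_add]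
        refine Real.one_le_exp (mul_nonneg hθ ?_)
        have := Finset.add_sum_erase Finset.univ (fun k => x (u k)) (Finset.mem_univ i)
        linarith [hnn i]
      linarith
  · intro κ hκ
    have hκ0 : ∀ i j, 0 ≤ κ i j := fun k j => by
      rcases hκ k with h | h <;> rw [h]
      exacts [hμ j, hν j]
    have hκ1 : ∀ i, ∑ j, κ i j = 1 := fun k => by
      rcases hκ k with h | h <;> rw [h]
      exacts [hμ1, hν1]
    have hκE : ∀ i, ∑ j, κ i j * Real.exp (θ * x j) ≤ E := fun k => by
      rcases hκ k with h | h <;> rw [h]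
      exacts [hμE, hνE]
    clear_value δ
    rw [prodSum_add, prodSum_const_mul]
    have h1 : prodSum κ (fun _ => δ) = δ := by
      have := prodSum_const_mul κ δ (fun _ => 1)
      rw [prodSum_one hκ1] at this
      simpa using this
    rw [h1]
    gcongr
    exact prodSum_exp_le hκ0 hκE

end Hybrid

/-! ### Points of the cube all of whose small subsets are shattered -/

/-- Each subset with at most `d` elements contributes at least `z ^ d` to the expansion of `(1 + z)
^ s.card`. The bound serves both the greedy choice of vectors and the count of halfspace labelings.
-/
lemma card_filter_card_le_mul_pow_le {ι : Type*} (s : Finset ι) (d : ℕ) {z : ℝ} (hz : 0 ≤ z)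
    (hz1 : z ≤ 1) :
    ((s.powerset.filter fun E => E.card ≤ d).card : ℝ) * z ^ d ≤ (1 + z) ^ s.card := by
  have h := Finset.sum_pow_mul_eq_add_pow z 1 s
  simp only [one_pow, mul_one] at h
  rw [add_comm 1 z, ← h, ← nsmul_eq_mul, ← Finset.sum_const]
  calc _ ≤ ∑ E ∈ s.powerset.filter (fun E => E.card ≤ d), z ^ E.card :=
        Finset.sum_le_sum fun E hE =>
          pow_le_pow_of_le_one hz hz1 (Finset.mem_filter.1 hE).2
    _ ≤ _ := Finset.sum_le_sum_of_subset_of_nonneg (Finset.filter_subset _ _)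
        fun E _ _ => pow_nonneg hz _

/-- The Gilbert–Varshamov bound: many vectors over `𝔽₂` without short linear dependencies. -/
lemma exists_finset_sum_ne_zero {n d k : ℕ} (hd : 1 ≤ d) {z : ℝ} (hz : 0 < z) (hz1 : z ≤ 1)
    (h : (1 + z) ^ k < z ^ d * 2 ^ n) :
    ∃ A : Finset (Fin n → ZMod 2), A.card = k ∧
      ∀ S ⊆ A, S.Nonempty → S.card ≤ d → ∑ v ∈ S, v ≠ 0 := by
  classical
  have key : ∀ j ≤ k, ∃ A : Finset (Fin n → ZMod 2), A.card = j ∧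
      ∀ S ⊆ A, S.Nonempty → S.card ≤ d → ∑ v ∈ S, v ≠ 0 := by
    intro j
    induction j with
    | zero =>
      refine fun _ => ⟨∅, rfl, fun S hS hne => ?_⟩
      rw [Finset.subset_empty.1 hS] at hne
      exact absurd hne Finset.not_nonempty_empty
    | succ j ih =>
      intro hj
      obtain ⟨A, hA, hAS⟩ := ih (by omega)
      -- Greedy step: a vector outside `B` creates no short dependency with `A`, and `B` is too
      -- small to fill the space. Singletons belong to the family since `1 ≤ d`, so the new vector
      -- is not already in `A`.
      set B := (A.powerset.filter fun E => E.card ≤ d).image fun E => ∑ v ∈ E, v with hB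
      have hcard : B.card < Fintype.card (Fin n → ZMod 2) := by
        have h1 := card_filter_card_le_mul_pow_le A d hz.le hz1
        have h2 : (1 + z) ^ A.card ≤ (1 + z) ^ k :=
          pow_le_pow_right₀ (by linarith) (by omega)
        have h3 : ((A.powerset.filter fun E => E.card ≤ d).card : ℝ) * z ^ d < 2 ^ n * z ^ d := by
          linarith
        have h4 := lt_of_mul_lt_mul_right h3 (pow_nonneg hz.le d)
        have h5 : (A.powerset.filter fun E => E.card ≤ d).card < 2 ^ n := by exact_mod_cast h4
        refine Finset.card_image_le.trans_lt ?_
        simpa [Fintype.card_fun, ZMod.card] using h5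
      obtain ⟨a, ha⟩ : ∃ a, a ∉ B := by
        by_contra! hall
        rw [Finset.eq_univ_of_forall hall, Finset.card_univ] at hcard
        exact lt_irrefl _ hcard
      have hmem : ∀ E ⊆ A, E.card ≤ d → ∑ v ∈ E, v ≠ a := fun E hE hEd hEa => by
        apply ha
        rw [hB, Finset.mem_image]
        exact ⟨E, Finset.mem_filter.2 ⟨Finset.mem_powerset.2 hE, hEd⟩, hEa⟩
      have haA : a ∉ A := fun h => hmem {a} (by simpa using h) (by simpa using hd) (by simp)
      refine ⟨insert a A, by rw [Finset.card_insert_of_notMem haA, hA], fun S hS hne hSd h0 => ?_⟩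
      by_cases haS : a ∈ S
      · rw [← Finset.add_sum_erase S _ haS] at h0
        refine hmem (S.erase a) ?_ ((Finset.card_erase_le).trans hSd) ?_
        · intro x hx
          have := hS (Finset.mem_of_mem_erase hx)
          exact (Finset.mem_insert.1 this).resolve_left (Finset.ne_of_mem_erase hx)
        · have h2 : ∀ x : Fin n → ZMod 2, x + x = 0 := fun x => by
            ext i
            exact CharTwo.add_self_eq_zero (x i)
          have h3 := h2 a
          exact (add_left_cancel (h3.trans h0.symm)).symm
      · refine hAS S (fun x hx => ?_) hne hSd h0
        exact (Finset.mem_insert.1 (hS hx)).resolve_left (by rintro rfl; exact haS hx)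
  exact key k le_rfl

/-- Over `𝔽₂` every nonzero coefficient is `1`, so a nontrivial relation is a vanishing sum over its
support. -/
lemma linearIndependent_of_sum_ne_zero {V : Type*} [AddCommGroup V] [Module (ZMod 2) V]
    {S : Finset V} (hS : ∀ T ⊆ S, T.Nonempty → ∑ v ∈ T, v ≠ 0) :
    LinearIndependent (ZMod 2) (fun v : S => (v : V)) := by
  classical
  rw [Fintype.linearIndependent_iff]
  intro g hg
  by_contra! hne
  obtain ⟨i, hi⟩ := hne
  have h01 : ∀ a : ZMod 2, a ≠ 0 → a = 1 := by decide
  set T := (Finset.univ.filter fun i => g i ≠ 0).map (Function.Embedding.subtype _) with hT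
  refine hS T ?_ ⟨i, ?_⟩ ?_
  · intro v hv
    simp only [hT, Finset.mem_map] at hv
    obtain ⟨w, _, rfl⟩ := hv
    exact w.2
  · simp [hT, hi]
  · rw [hT, Finset.sum_map, Finset.sum_filter]
    refine Eq.trans (Finset.sum_congr rfl fun j _ => ?_) hg
    by_cases hj : g j = 0
    · simp [hj]
    · simp [h01 _ hj]

/-- The `0/1` lifts to `ℝ` of vectors independent over `𝔽₂` are independent: they carry linear
functionals with arbitrary values. -/
lemma exists_dual_of_linearIndependent {n : ℕ} {S : Finset (Fin n → ZMod 2)}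
    (hS : LinearIndependent (ZMod 2) (fun v : S => (v : Fin n → ZMod 2))) (y : S → ℝ) :
    ∃ w : Fin n → ℝ, ∀ s : S, ∑ i, w i * (((s : Fin n → ZMod 2) i).val : ℝ) = y s := by
  classical
  have hφ : ∀ s : S, ∃ φ : (Fin n → ZMod 2) →ₗ[ZMod 2] ZMod 2,
      ∀ s' : S, φ s' = if s' = s then 1 else 0 := fun s => by
    obtain ⟨φ, hφ⟩ := LinearMap.exists_extend ((Finsupp.lapply s).comp hS.repr)
    refine ⟨φ, fun s' => ?_⟩
    have hmem : (s' : Fin n → ZMod 2) ∈ Submodule.span (ZMod 2)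
        (Set.range fun v : S => (v : Fin n → ZMod 2)) := Submodule.subset_span ⟨s', rfl⟩
    have h1 := LinearMap.congr_fun hφ ⟨s', hmem⟩
    simp only [LinearMap.comp_apply, Submodule.subtype_apply] at h1
    rw [h1, hS.repr_eq_single s' _ rfl, Finsupp.lapply_apply, Finsupp.single_apply]
  choose φ hφ using hφ
  -- `B` lifts a dual family over `𝔽₂` to the integers. The pairing matrix `G` reduces to the
  -- identity modulo `2`, so its determinant is odd and remains invertible over `ℝ`.
  let B : S → Fin n → ℤ := fun s i => (φ s fun j => if i = j then 1 else 0).val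
  let G : Matrix S S ℤ := Matrix.of fun s s' => ∑ i, B s i * ((s' : Fin n → ZMod 2) i).val
  have hG : (Int.castRingHom (ZMod 2)).mapMatrix G = 1 := by
    ext s s'
    rw [RingHom.mapMatrix_apply, Matrix.map_apply, Matrix.one_apply]
    have h1 := hφ s s'
    rw [LinearMap.pi_apply_eq_sum_univ] at h1
    simp only [eq_comm (a := s)]
    rw [← h1]
    simp only [G, B, Matrix.of_apply, map_sum, map_mul, eq_intCast, Int.cast_natCast,
      ZMod.natCast_zmod_val]
    refine Finset.sum_congr rfl fun i _ => ?_
    rw [smul_eq_mul, mul_comm]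
  have hdet : G.det ≠ 0 := fun h0 => by
    have h1 := RingHom.map_det (Int.castRingHom (ZMod 2)) G
    rw [hG, h0, Matrix.det_one, map_zero] at h1
    exact zero_ne_one h1
  set GR : Matrix S S ℝ := (Int.castRingHom ℝ).mapMatrix G with hGR
  have hdetR : IsUnit GR.det := by
    rw [hGR, ← RingHom.map_det, isUnit_iff_ne_zero]
    simpa using hdet
  obtain ⟨c, hc⟩ : ∃ c, Matrix.vecMul c GR = y := ⟨Matrix.vecMul y GR⁻¹, by
    rw [Matrix.vecMul_vecMul, Matrix.nonsing_inv_mul _ hdetR, Matrix.vecMul_one]⟩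
  have hGRa : ∀ s s', GR s s' = ∑ i, (B s i : ℝ) * (((s' : Fin n → ZMod 2) i).val : ℝ) :=
    fun s s' => by simp [hGR, G]
  refine ⟨fun i => ∑ s, c s * B s i, fun s' => ?_⟩
  rw [← hc]
  simp only [Matrix.vecMul, dotProduct, hGRa, Finset.sum_mul, Finset.mul_sum]
  rw [Finset.sum_comm]
  exact Finset.sum_congr rfl fun s _ => Finset.sum_congr rfl fun i _ => by ring

/-- The point of `{±1}^n` with coordinates `(-1) ^ v i`. -/
def cubeOfZMod {n : ℕ} (v : Fin n → ZMod 2) : Cube n := fun i => if v i = 0 then 1 else -1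

lemma cubeOfZMod_injective {n : ℕ} : Function.Injective (cubeOfZMod (n := n)) := by
  intro v w h
  funext i
  have h1 := congrFun h i
  have h01 : ∀ a b : ZMod 2, (a = 0 ↔ b = 0) → a = b := by decide
  refine h01 _ _ ?_
  simp only [cubeOfZMod] at h1
  split_ifs at h1 with h2 h3 h3
  · simp [h2, h3]
  · exact absurd h1 (by decide)
  · exact absurd h1 (by decide)
  · simp [h2, h3]

lemma cubeOfZMod_cast {n : ℕ} (v : Fin n → ZMod 2) (i : Fin n) :
    (((cubeOfZMod v i : ℤˣ) : ℤ) : ℝ) = 1 - 2 * ((v i).val : ℝ) := by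
  have h01 : ∀ a : ZMod 2, a = 0 ∨ a = 1 := by decide
  rcases h01 (v i) with h | h
  · simp [cubeOfZMod, h]
  · simp [cubeOfZMod, h, ZMod.val_one]; norm_num

/-- With threshold `∑ w i` and weights `-w i`, the affine form at the point `1 - 2v` equals twice
the pairing of `w` with `v`. Prescribing that pairing as `±1` realizes every labeling and avoids the
tie at `0`. -/
lemma exists_halfspace_of_linearIndependent {n : ℕ} {S : Finset (Fin n → ZMod 2)}
    (hS : LinearIndependent (ZMod 2) (fun v : S => (v : Fin n → ZMod 2))) (g : Cube n → Bool) :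
    ∃ h ∈ halfspaces n, ∀ s ∈ S, h (cubeOfZMod s) = g (cubeOfZMod s) := by
  obtain ⟨w, hw⟩ := exists_dual_of_linearIndependent hS
    (fun s => if g (cubeOfZMod s) = true then 1 else -1)
  refine ⟨fun x => decide (0 ≤ (∑ i, w i) + ∑ i, (-w i) * (((x i : ℤˣ) : ℤ) : ℝ)),
    ⟨∑ i, w i, fun i => -w i, fun x => by simp⟩, fun s hs => ?_⟩
  have h1 : (∑ i, w i) + ∑ i, (-w i) * (((cubeOfZMod s i : ℤˣ) : ℤ) : ℝ) =
      2 * if g (cubeOfZMod s) = true then 1 else -1 := by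
    rw [← hw ⟨s, hs⟩, Finset.mul_sum, ← Finset.sum_add_distrib]
    refine Finset.sum_congr rfl fun i _ => ?_
    rw [cubeOfZMod_cast]
    ring
  simp only [h1]
  cases g (cubeOfZMod s) <;> simp

/-! ### A function far from all halfspaces -/

/-- The VC dimension of halfspaces is at most `n + 1`. -/
lemma card_le_of_shatters_halfspaces {n : ℕ} {ι : Type*} [DecidableEq ι] (t : ι → Cube n)
    {𝒜 : Finset (Finset ι)}
    (h𝒜 : ∀ E ∈ 𝒜, ∃ h ∈ halfspaces n, ∀ i, i ∈ E ↔ h (t i) = true) {s : Finset ι}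
    (hs : 𝒜.Shatters s) : s.card ≤ n + 1 := by
  by_contra! hlt
  -- The coordinate `none` is the constant `1` that accounts for the threshold; more than `n + 1`
  -- such vectors are dependent.
  let a : s → Option (Fin n) → ℝ := fun i o => o.elim 1 fun k => (((t i k : ℤˣ) : ℤ) : ℝ)
  have hdep : ¬ LinearIndependent ℝ a := fun hli => by
    have := hli.fintype_card_le_finrank
    simp at this
    omega
  obtain ⟨g, hg, i₀, hi₀⟩ := Fintype.not_linearIndependent_iff.1 hdep
  -- Radon-type argument: shattering yields an affine form `L` with the sign pattern of the relation
  -- `g`, so `∑ g i * L i` is both zero and a sum of nonnegative terms. As `L` may vanish where it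
  -- labels `true`, strictness is certain only at a negative coefficient, hence the later use of
  -- `-g`.
  have main : ∀ g : s → ℝ, ∑ i, g i • a i = 0 → ∀ i₀, ¬ g i₀ < 0 := by
    intro g hg i₀ hi₀
    obtain ⟨u, hu, hsu⟩ := hs (t := (Finset.univ.filter fun i => 0 ≤ g i).map
      (Function.Embedding.subtype _)) (fun x hx => by
        simp only [Finset.mem_map] at hx
        obtain ⟨y, _, rfl⟩ := hx
        exact y.2)
    have hmem : ∀ i : s, (i : ι) ∈ u ↔ 0 ≤ g i := fun i => by
      have h1 := Finset.ext_iff.1 hsu i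
      simpa using h1
    obtain ⟨h, ⟨w₀, w, hw⟩, hE⟩ := h𝒜 u hu
    set L : s → ℝ := fun i => w₀ + ∑ k, w k * (((t i k : ℤˣ) : ℤ) : ℝ) with hL
    have hLi : ∀ i, 0 ≤ L i ↔ 0 ≤ g i := fun i => by
      rw [← hmem, hE, hw]
    have hsum : ∑ i, g i * L i = 0 := by
      have h1 : ∀ o, ∑ i, g i * a i o = 0 := fun o => by
        have := congrFun hg o
        simpa [Finset.sum_apply] using this
      have h2 : ∑ i, g i * L i = w₀ * ∑ i, g i * a i none +
          ∑ k, w k * ∑ i, g i * a i (some k) := by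
        simp only [hL, mul_add, Finset.sum_add_distrib, Finset.mul_sum]
        congr 1
        · exact Finset.sum_congr rfl fun i _ => by simp [a, mul_comm]
        · rw [Finset.sum_comm]
          exact Finset.sum_congr rfl fun k _ => Finset.sum_congr rfl fun i _ => by
            simp only [a, Option.elim]; ring
      rw [h2]
      simp only [h1, mul_zero, Finset.sum_const_zero, add_zero]
    have hpos : 0 < ∑ i, g i * L i := by
      refine Finset.sum_pos' (fun i _ => ?_) ⟨i₀, Finset.mem_univ _, ?_⟩
      · by_cases hi : 0 ≤ g i
        · exact mul_nonneg hi ((hLi i).2 hi)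
        · have : ¬ 0 ≤ L i := fun h => hi ((hLi i).1 h)
          push Not at hi this
          exact (mul_pos_of_neg_of_neg hi this).le
      · have : ¬ 0 ≤ L i₀ := fun h => absurd ((hLi i₀).1 h) (not_le.2 hi₀)
        push Not at this
        exact mul_pos_of_neg_of_neg hi₀ this
    exact hpos.ne' hsum
  rcases lt_or_gt_of_ne hi₀ with h | h
  · exact main g hg i₀ h
  · refine main (fun i => -g i) ?_ i₀ (by simpa using h)
    simp only [neg_smul, Finset.sum_neg_distrib, hg, neg_zero]

open scoped symmDiff in
/-- Halfspaces have few labelings on many points, so some labeling is far from all of them. -/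
lemma exists_far_labeling {n : ℕ} (hn : 1 ≤ n) (t : Fin (32 * n) → Cube n) :
    ∃ F : Finset (Fin (32 * n)), ∀ h ∈ halfspaces n,
      2 * n < (Finset.univ.filter fun i => ¬ (h (t i) = true ↔ i ∈ F)).card := by
  classical
  obtain ⟨𝒜, h𝒜⟩ : ∃ 𝒜 : Finset (Finset (Fin (32 * n))),
      ∀ E, E ∈ 𝒜 ↔ ∃ h ∈ halfspaces n, ∀ i, i ∈ E ↔ h (t i) = true :=
    ⟨Finset.univ.filter fun E => ∃ h ∈ halfspaces n, ∀ i, i ∈ E ↔ h (t i) = true,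
      fun E => by rw [Finset.mem_filter]; simp only [Finset.mem_univ, true_and]⟩
  set small : ℕ → Finset (Finset (Fin (32 * n))) := fun d =>
    (Finset.univ.powerset).filter fun E => E.card ≤ d with hs
  have hmem : ∀ d E, E ∈ small d ↔ E.card ≤ d := fun d E => by simp [hs]
  -- Sauer–Shelah: a family is no larger than the family of sets it shatters.
  have hA : 𝒜.card ≤ (small (n + 1)).card := by
    refine 𝒜.card_le_card_shatterer.trans (Finset.card_le_card fun s hs => ?_)
    rw [Finset.mem_shatterer] at hs
    exact (hmem _ _).2 (card_le_of_shatters_halfspaces t (fun E hE => (h𝒜 E).1 hE) hs)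
  have hsmall : ∀ d, ((small d).card : ℝ) ≤ 8 ^ d * (9 / 8) ^ (32 * n) := fun d => by
    have := card_filter_card_le_mul_pow_le (Finset.univ : Finset (Fin (32 * n))) d
      (z := 1 / 8) (by norm_num) (by norm_num)
    have h8 : (8 : ℝ) ^ d * (1 / 8) ^ d = 1 := by rw [← mul_pow]; norm_num
    rw [Finset.card_univ, Fintype.card_fin, show (1 + 1 / 8 : ℝ) = 9 / 8 by norm_num] at this
    calc ((small d).card : ℝ) = 8 ^ d * ((small d).card * (1 / 8) ^ d) := by
          linear_combination (-((small d).card : ℝ)) * h8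
      _ ≤ _ := by gcongr
  clear_value small
  -- These are the labelings within `2 n` errors of a halfspace. As `(9 / 8) ^ 4 ≤ 2`, there are at
  -- most `2 ^ (25 n + 3)` of them, fewer than `2 ^ (32 n)`.
  let bad := (𝒜 ×ˢ small (2 * n)).image fun p => p.1 ∆ p.2
  have hbad : bad.card < Fintype.card (Finset (Fin (32 * n))) := by
    have h1 : bad.card ≤ 𝒜.card * (small (2 * n)).card := by
      rw [← Finset.card_product]; exact Finset.card_image_le
    have h2 : (bad.card : ℝ) ≤
        (8 ^ (n + 1) * (9 / 8) ^ (32 * n)) * (8 ^ (2 * n) * (9 / 8) ^ (32 * n)) := by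
      calc (bad.card : ℝ) ≤ (𝒜.card : ℝ) * (small (2 * n)).card := by exact_mod_cast h1
        _ ≤ ((small (n + 1)).card : ℝ) * (small (2 * n)).card := by gcongr
        _ ≤ _ := mul_le_mul (hsmall _) (hsmall _) (by positivity) (by positivity)
    have h3 : (8 ^ (n + 1) * (9 / 8) ^ (32 * n)) * (8 ^ (2 * n) * (9 / 8) ^ (32 * n)) <
        (2 : ℝ) ^ (32 * n) := by
      calc _ = (2 : ℝ) ^ (9 * n + 3) * ((9 / 8) ^ 4) ^ (16 * n) := by
            rw [show (8 : ℝ) = 2 ^ 3 by norm_num, ← pow_mul, ← pow_mul, ← pow_mul]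
            ring_nf
        _ ≤ (2 : ℝ) ^ (9 * n + 3) * 2 ^ (16 * n) := by
          gcongr
          norm_num
        _ = (2 : ℝ) ^ (9 * n + 3 + 16 * n) := (pow_add _ _ _).symm
        _ < 2 ^ (32 * n) := pow_lt_pow_right₀ (by norm_num) (by omega)
    rw [Fintype.card_finset, Fintype.card_fin]
    exact_mod_cast h2.trans_lt h3
  obtain ⟨F, hF⟩ : ∃ F, F ∉ bad := by
    by_contra! hall
    rw [Finset.eq_univ_of_forall hall, Finset.card_univ] at hbad
    exact lt_irrefl _ hbad
  refine ⟨F, fun h hh => ?_⟩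
  by_contra! hle
  apply hF
  set E := Finset.univ.filter fun i => h (t i) = true with hE
  refine Finset.mem_image.2 ⟨(E, E ∆ F), Finset.mem_product.2 ⟨?_, ?_⟩, ?_⟩
  · exact (h𝒜 E).2 ⟨h, hh, fun i => by simp [hE]⟩
  · refine (hmem _ _).2 (le_trans (Finset.card_le_card fun i hi => ?_) hle)
    rw [Finset.mem_symmDiff] at hi
    simp only [hE, Finset.mem_filter, Finset.mem_univ, true_and] at hi ⊢
    tauto
  · exact symmDiff_symmDiff_cancel_left E F

/-- Points of the cube and a function that agrees with a halfspace on each small set of these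
points, while each halfspace errs on a constant fraction of them. -/
lemma exists_hard_function {n d : ℕ} (hn : 2 ≤ n) (hd : 1 ≤ d) (hdn : 28 * d ≤ n) :
    ∃ (t : Fin (32 * n) → Cube n) (t₀ : Cube n) (f : Cube n → Bool), Function.Injective t ∧
      (∀ S : Finset (Fin (32 * n)), S.card + 1 ≤ d →
        ∃ h ∈ halfspaces n, h t₀ = f t₀ ∧ ∀ i ∈ S, h (t i) = f (t i)) ∧
      ∀ h ∈ halfspaces n, 2 * n < (Finset.univ.filter fun i => h (t i) ≠ f (t i)).card := by
  classical
  -- The exponent has one extra point, for `t₀`. The inequality is squared to use `(1 + 1 / 128) ^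
  -- 64 ≤ 2`; since `128 = 2 ^ 7`, what remains is `14 d + 1 ≤ n`, which `28 d ≤ n` provides.
  have hnum : (1 + 1 / 128 : ℝ) ^ (32 * n + 1) < (1 / 128) ^ d * 2 ^ n := by
    have h1 : ((1 + 1 / 128 : ℝ) ^ (32 * n + 1)) ^ 2 < 2 ^ (n + 1) := by
      calc ((1 + 1 / 128 : ℝ) ^ (32 * n + 1)) ^ 2 =
            ((1 + 1 / 128 : ℝ) ^ 64) ^ n * (1 + 1 / 128) ^ 2 := by
            rw [← pow_mul, ← pow_mul, ← pow_add]; ring_nf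
        _ ≤ 2 ^ n * (1 + 1 / 128) ^ 2 := by gcongr; norm_num
        _ < 2 ^ (n + 1) := by
          rw [pow_succ]
          exact mul_lt_mul_of_pos_left (by norm_num) (by positivity)
    have h2 : (2 : ℝ) ^ (n + 1) ≤ ((1 / 128) ^ d * 2 ^ n) ^ 2 := by
      have h3 : (2 : ℝ) ^ (n + 1) * (128 ^ d) ^ 2 ≤ (2 ^ n) ^ 2 := by
        rw [show (128 : ℝ) = 2 ^ 7 by norm_num, ← pow_mul, ← pow_mul, ← pow_mul, ← pow_add]
        exact pow_le_pow_right₀ (by norm_num) (by omega)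
      rw [mul_pow, one_div, inv_pow, inv_pow, mul_comm, ← div_eq_mul_inv,
        le_div_iff₀ (by positivity)]
      exact h3
    exact lt_of_pow_lt_pow_left₀ 2 (by positivity) (h1.trans_le h2)
  obtain ⟨A, hA, hAS⟩ := exists_finset_sum_ne_zero hd (by norm_num) (by norm_num) hnum
  let e : Fin (32 * n + 1) ≃ A := (Fintype.equivFinOfCardEq (by simp [hA])).symm
  have he : Function.Injective fun i => cubeOfZMod (e i : Fin n → ZMod 2) :=
    cubeOfZMod_injective.comp (Subtype.val_injective.comp e.injective)
  set t : Fin (32 * n) → Cube n := fun i => cubeOfZMod (e i.castSucc : Fin n → ZMod 2) with ht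
  have htinj : Function.Injective t := he.comp (Fin.castSucc_injective _)
  obtain ⟨F, hF⟩ := exists_far_labeling (by omega) t
  set f : Cube n → Bool := fun x => decide (∃ i ∈ F, t i = x) with hf
  have hft : ∀ i, f (t i) = true ↔ i ∈ F := fun i => by
    simp [hf, htinj.eq_iff]
  refine ⟨t, cubeOfZMod (e (Fin.last _) : Fin n → ZMod 2), f, htinj, fun S hS => ?_,
    fun h hh => ?_⟩
  · set S' : Finset (Fin n → ZMod 2) := insert (e (Fin.last _) : Fin n → ZMod 2)
      (S.image fun i => (e i.castSucc : Fin n → ZMod 2)) with hS'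
    have hcard : S'.card ≤ d := (Finset.card_insert_le _ _).trans
      ((Nat.succ_le_succ Finset.card_image_le).trans hS)
    have hsub : S' ⊆ A := by
      intro v hv
      rw [hS', Finset.mem_insert, Finset.mem_image] at hv
      rcases hv with rfl | ⟨i, _, rfl⟩
      exacts [(e _).2, (e _).2]
    obtain ⟨h, hh, hhS⟩ := exists_halfspace_of_linearIndependent
      (linearIndependent_of_sum_ne_zero fun T hT hne =>
        hAS T (hT.trans hsub) hne ((Finset.card_le_card hT).trans hcard)) f
    exact ⟨h, hh, hhS _ (Finset.mem_insert_self _ _), fun i hi =>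
      hhS _ (Finset.mem_insert_of_mem (Finset.mem_image_of_mem _ hi))⟩
  · refine (hF h hh).trans_le (Finset.card_le_card fun i hi => ?_)
    simp only [Finset.mem_filter, Finset.mem_univ, true_and] at hi ⊢
    intro heq
    apply hi
    rw [heq, hft]

/-! ### Acceptance probabilities of testers -/

lemma sum_pmf_eq_one {X : Type*} [Fintype X] (D : PMF X) : ∑ x, D x = 1 := by
  rw [← tsum_fintype (L := .unconditional _)]
  exact D.tsum_coe

lemma sum_pmf_toReal_eq_one {X : Type*} [Fintype X] (D : PMF X) : ∑ x, (D x).toReal = 1 := by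
  rw [← ENNReal.toReal_sum fun x _ => D.apply_ne_top x, sum_pmf_eq_one, ENNReal.toReal_one]

lemma SamplePoly.mem_Icc_toReal {X : Type*} [Fintype X] {q : ℕ} {Φ : (X → ℝ) → ℝ}
    (h : SamplePoly q Φ) (D : PMF X) :
    0 ≤ Φ (fun x => (D x).toReal) ∧ Φ (fun x => (D x).toReal) ≤ 1 :=
  h.mem_Icc (fun _ => ENNReal.toReal_nonneg) (sum_pmf_toReal_eq_one D)

/-- `acc` is the acceptance probability of a random choice among algorithms drawing at most `q`
samples. -/
def IsSampleMixture {X : Type} [Fintype X] (q : ℕ) (acc : PMF X → ℝ≥0∞) : Prop :=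
  ∃ (κ : Type) (A : PMF κ) (Φ : κ → (X → ℝ) → ℝ), (∀ k, SamplePoly q (Φ k)) ∧
    ∀ D, acc D = ∑' k, A k * ENNReal.ofReal (Φ k fun x => (D x).toReal)

/-- Once `f` is fixed, the answers to queries are known. A query therefore spends budget without
involving `D`, and only samples raise the degree. -/
lemma AdaptiveTree.exists_samplePoly {X : Type} [Fintype X] (f : X → Bool) {q : ℕ}
    (T : AdaptiveTree X q) :
    ∃ Φ, SamplePoly q Φ ∧ ∀ D, T.run f D true = ENNReal.ofReal (Φ fun x => (D x).toReal) := by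
  induction T with
  | @output q b =>
    refine ⟨fun _ => if b = true then 1 else 0, .const q ?_ ?_, fun D => ?_⟩
    · split_ifs <;> norm_num
    · split_ifs <;> norm_num
    · cases b <;> simp [AdaptiveTree.run]
  | sample next ih =>
    choose Φ hΦ hrun using fun x => ih x (f x)
    refine ⟨_, .sample Φ hΦ, fun D => ?_⟩
    rw [AdaptiveTree.run, PMF.bind_apply, tsum_fintype,
      ENNReal.ofReal_sum_of_nonneg fun x _ =>
        mul_nonneg ENNReal.toReal_nonneg ((hΦ x).mem_Icc_toReal D).1]
    refine Finset.sum_congr rfl fun x _ => ?_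
    rw [hrun, ENNReal.ofReal_mul ENNReal.toReal_nonneg, ENNReal.ofReal_toReal (D.apply_ne_top x)]
  | query x next ih =>
    obtain ⟨Φ, hΦ, hrun⟩ := ih (f x)
    exact ⟨Φ, hΦ.succ, fun D => by simp only [AdaptiveTree.run]; exact hrun D⟩

lemma AdaptiveAlg.isSampleMixture {X : Type} [Fintype X] {q : ℕ} (A : AdaptiveAlg X q)
    (f : X → Bool) : IsSampleMixture q fun D => A.run f D true := by
  choose Φ hΦ hrun using AdaptiveTree.exists_samplePoly (q := q) f
  refine ⟨AdaptiveTree X q, A, Φ, hΦ, fun D => ?_⟩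
  change (PMF.bind A fun T => T.run f D) true = _
  rw [PMF.bind_apply]
  exact tsum_congr fun T => by rw [hrun]

lemma samplePoly_sum_prod {X : Type*} [Fintype X] {m : ℕ} (a : (Fin m → X) → ℝ)
    (h₀ : ∀ s, 0 ≤ a s) (h₁ : ∀ s, a s ≤ 1) :
    SamplePoly m fun p => ∑ s, (∏ i, p (s i)) * a s := by
  induction m with
  | zero =>
    have h : (fun p : X → ℝ => ∑ s : Fin 0 → X, (∏ i, p (s i)) * a s) =
        fun _ => a default := by
      ext p
      simp
    rw [h]
    exact .const 0 (h₀ _) (h₁ _)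
  | succ m ih =>
    have h : (fun p : X → ℝ => ∑ s : Fin (m + 1) → X, (∏ i, p (s i)) * a s) =
        fun p => ∑ x, p x * ∑ s : Fin m → X, (∏ i, p (s i)) * a (Fin.cons x s) := by
      ext p
      rw [← Equiv.sum_comp (Fin.consEquiv fun _ => X), Fintype.sum_prod_type]
      refine Finset.sum_congr rfl fun x _ => ?_
      rw [Finset.mul_sum]
      refine Finset.sum_congr rfl fun s _ => ?_
      simp [Fin.consEquiv, Fin.prod_univ_succ, mul_assoc]
    rw [h]
    exact .sample _ fun x => ih _ (fun s => h₀ _) fun s => h₁ _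

lemma SampleAlg.isSampleMixture {X : Type} [Fintype X] {m : ℕ} (A : SampleAlg X m)
    (f : X → Bool) : IsSampleMixture m fun D => A.run f D true := by
  let a : (Fin m → X) → ℝ := fun s => (A (fun i => (s i, f (s i))) true).toReal
  have ha0 : ∀ s, 0 ≤ a s := fun s => ENNReal.toReal_nonneg
  refine ⟨Unit, PMF.pure (), fun _ p => ∑ s, (∏ i, p (s i)) * a s, fun _ =>
    samplePoly_sum_prod a ha0 fun s => ?_, fun D => ?_⟩
  · exact ENNReal.toReal_le_of_le_ofReal zero_le_one (by simpa using PMF.coe_le_one _ _)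
  · rw [tsum_fintype]
    simp only [Finset.univ_unique, PUnit.default_eq_unit, PMF.pure_apply, if_true, one_mul,
      Finset.sum_singleton]
    rw [SampleAlg.run, PMF.bind_apply, tsum_fintype, ENNReal.ofReal_sum_of_nonneg fun s _ =>
      mul_nonneg (Finset.prod_nonneg fun i _ => ENNReal.toReal_nonneg) (ha0 s)]
    refine Finset.sum_congr rfl fun s _ => ?_
    rw [ENNReal.ofReal_mul (Finset.prod_nonneg fun i _ => ENNReal.toReal_nonneg),
      ENNReal.ofReal_toReal (PMF.apply_ne_top _ _),
      ENNReal.ofReal_prod_of_nonneg fun i _ => ENNReal.toReal_nonneg, iid, PMF.ofFintype_apply]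
    congr 1
    exact Finset.prod_congr rfl fun i _ => (ENNReal.ofReal_toReal (D.apply_ne_top _)).symm

lemma IsSampleMixture.hasSum_toReal {X : Type} [Fintype X] {q : ℕ} {acc : PMF X → ℝ≥0∞}
    {κ : Type} {A : PMF κ} {Φ : κ → (X → ℝ) → ℝ} (hΦ : ∀ k, SamplePoly q (Φ k))
    (h : ∀ D, acc D = ∑' k, A k * ENNReal.ofReal (Φ k fun x => (D x).toReal)) (D : PMF X) :
    HasSum (fun k => (A k).toReal * Φ k fun x => (D x).toReal) (acc D).toReal := by
  have hle : ∑' k, A k * ENNReal.ofReal (Φ k fun x => (D x).toReal) ≤ 1 := by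
    rw [← A.tsum_coe]
    refine ENNReal.tsum_le_tsum fun k => mul_le_of_le_one_right' ?_
    exact ENNReal.ofReal_le_one.2 ((hΦ k).mem_Icc_toReal D).2
  have hne := (hle.trans_lt ENNReal.one_lt_top).ne
  have h1 := ENNReal.hasSum_toReal hne
  rw [← ENNReal.tsum_toReal_eq fun k => ENNReal.ne_top_of_tsum_ne_top hne k, ← h] at h1
  convert h1 using 2 with k
  rw [ENNReal.toReal_mul, ENNReal.toReal_ofReal ((hΦ k).mem_Icc_toReal D).1]

/-! ### Testers with few samples cannot exist -/

/-- The distribution with weights `pointWeight t t₀ w`. -/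
noncomputable def pointPMF {X ι : Type*} [Fintype X] [DecidableEq X] [Fintype ι] (t : ι → X)
    (t₀ : X) (w : ι → ℝ) (hw : ∀ i, 0 ≤ w i) (hw1 : ∑ i, w i ≤ 1) : PMF X :=
  PMF.ofFintype (fun x => ENNReal.ofReal (pointWeight t t₀ w x)) (by
    rw [← ENNReal.ofReal_sum_of_nonneg fun x _ => pointWeight_nonneg t t₀ hw hw1 x,
      sum_pointWeight, ENNReal.ofReal_one])

lemma pointPMF_toReal {X ι : Type*} [Fintype X] [DecidableEq X] [Fintype ι] (t : ι → X)
    (t₀ : X) {w : ι → ℝ} (hw : ∀ i, 0 ≤ w i) (hw1 : ∑ i, w i ≤ 1) :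
    (fun x => (pointPMF t t₀ w hw hw1 x).toReal) = pointWeight t t₀ w := by
  ext x
  rw [pointPMF, PMF.ofFintype_apply, ENNReal.toReal_ofReal (pointWeight_nonneg t t₀ hw hw1 x)]

lemma exists_of_pointPMF_ne_zero {X ι : Type*} [Fintype X] [DecidableEq X] [Fintype ι] {t : ι → X}
    {t₀ : X} {w : ι → ℝ} {hw : ∀ i, 0 ≤ w i} {hw1 : ∑ i, w i ≤ 1} {x : X}
    (hx : pointPMF t t₀ w hw hw1 x ≠ 0) : x = t₀ ∨ ∃ i, w i ≠ 0 ∧ t i = x := by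
  by_contra! h
  apply hx
  have h0 : pointWeight t t₀ w x = 0 := by
    rw [pointWeight, if_neg (fun h' => h.1 h'.symm), add_zero]
    refine Finset.sum_eq_zero fun i _ => ?_
    split_ifs with hi
    · by_contra hne; exact h.2 i hne hi
    · rfl
  rw [pointPMF, PMF.ofFintype_apply, h0, ENNReal.ofReal_zero]

lemma ofReal_le_distD_pointPMF {X ι : Type*} [Fintype X] [DecidableEq X] [Fintype ι] {t : ι → X}
    (t₀ : X) {w : ι → ℝ} (hw : ∀ i, 0 ≤ w i) (hw1 : ∑ i, w i ≤ 1) (ht : Function.Injective t)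
    {f h : X → Bool} {η : ℝ} (hη : ∀ i, η ≤ w i) :
    ENNReal.ofReal ((Finset.univ.filter fun i => h (t i) ≠ f (t i)).card * η) ≤
      distD (pointPMF t t₀ w hw hw1) f h := by
  set S := Finset.univ.filter fun i => h (t i) ≠ f (t i) with hS
  have hw' : ∀ i, ENNReal.ofReal η ≤ pointPMF t t₀ w hw hw1 (t i) := fun i => by
    rw [pointPMF, PMF.ofFintype_apply]
    refine ENNReal.ofReal_le_ofReal ((hη i).trans ?_)
    rw [pointWeight]
    have h1 : w i ≤ ∑ k, if t k = t i then w k else 0 := by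
      have := Finset.single_le_sum (f := fun k => if t k = t i then w k else 0)
        (fun k _ => by split_ifs; exacts [hw k, le_rfl]) (Finset.mem_univ i)
      simpa using this
    have h2 : (0 : ℝ) ≤ if t₀ = t i then 1 - ∑ k, w k else 0 := by
      split_ifs; exacts [by linarith, le_rfl]
    linarith
  calc ENNReal.ofReal (S.card * η) = ∑ i ∈ S, ENNReal.ofReal η := by
        rw [Finset.sum_const, nsmul_eq_mul, ENNReal.ofReal_mul (by positivity),
          ENNReal.ofReal_natCast]
    _ ≤ ∑ i ∈ S, pointPMF t t₀ w hw hw1 (t i) := Finset.sum_le_sum fun i _ => hw' i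
    _ = ∑ x ∈ S.map ⟨t, ht⟩, pointPMF t t₀ w hw hw1 x := by rw [Finset.sum_map]; rfl
    _ = (pointPMF t t₀ w hw hw1).toOuterMeasure (S.map ⟨t, ht⟩ : Finset X) := by
      rw [PMF.toOuterMeasure_apply_finset]
    _ ≤ _ := by
      refine MeasureTheory.measure_mono ?_
      intro x hx
      simp only [Finset.coe_map, Set.mem_image, Finset.mem_coe] at hx
      obtain ⟨i, hi, rfl⟩ := hx
      exact fun h => (Finset.mem_filter.1 hi).2 h.symm

lemma exp_le_one_add_two_mul {y : ℝ} (h0 : 0 ≤ y) (h1 : y ≤ 1) : Real.exp y ≤ 1 + 2 * y := by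
  have h := (abs_le.1 (Real.abs_exp_sub_one_sub_id_le (x := y) (by rw [abs_of_nonneg h0]; exact h1))).2
  nlinarith

/-- The bound of the hybrid argument is small once `M ≥ log n` and `q M` is at most a small
multiple of `n`. -/
lemma hybrid_bound_le {n q M : ℕ} (hn : 1280 ≤ n) (hM : 1 ≤ M) (hlog : Real.log n ≤ M)
    (hM3 : 1050000 * M ^ 3 ≤ 1024 * n) (hq : 10000 * (q * M) ≤ n) {r : ℝ}
    (hr : r = 350000 * (M : ℝ) ^ 2 / (2048 * n)) :
    ((32 * n : ℕ) : ℝ) * (2 * (r / (Real.exp 4 * r)) ^ (M + 1) * (1 + 2 * (Real.exp 4 * r)) ^ q +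
      2 * Real.exp (1 / r * (r - 1)) * (1 + 22 / (2048 * n * r)) ^ (32 * n)) ≤ 1 / 10 := by
  have hn0 : (1280 : ℝ) ≤ n := by exact_mod_cast hn
  have hM0 : (1 : ℝ) ≤ M := by exact_mod_cast hM
  have hM3' : 1050000 * (M : ℝ) ^ 3 ≤ 1024 * n := by exact_mod_cast hM3
  have hq' : 10000 * ((q : ℝ) * M) ≤ n := by exact_mod_cast hq
  have hr0 : 0 < r := by rw [hr]; positivity
  have hexp2 : Real.exp (-(2 * M)) ≤ 1 / (n : ℝ) ^ 2 := by
    have h1 : (n : ℝ) ≤ Real.exp M := by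
      rw [← Real.log_le_iff_le_exp (by linarith)]; exact hlog
    rw [Real.exp_neg, ← one_div, two_mul, Real.exp_add, ← sq]
    gcongr
  -- The ratio of radii contributes `exp (-4 (M + 1))`. The majorant costs at most `exp (2 M)`, and
  -- it is here that `q M` must be small compared with `n`.
  have hfirst : (r / (Real.exp 4 * r)) ^ (M + 1) * (1 + 2 * (Real.exp 4 * r)) ^ q ≤
      Real.exp (-(2 * M)) := by
    have h1 : r / (Real.exp 4 * r) = Real.exp (-4) := by
      rw [Real.exp_neg]; field_simp
    have h2 : (1 + 2 * (Real.exp 4 * r)) ^ q ≤ Real.exp (q * (2 * (Real.exp 4 * r))) := by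
      rw [Real.exp_nat_mul]
      gcongr
      linarith [Real.add_one_le_exp (2 * (Real.exp 4 * r))]
    have h3 : Real.exp 4 ≤ 55 := by
      have h := Real.exp_one_lt_d9
      rw [show (4 : ℝ) = (4 : ℕ) * 1 by norm_num, Real.exp_nat_mul]
      calc Real.exp 1 ^ 4 ≤ 2.7182818286 ^ 4 := by gcongr
        _ ≤ 55 := by norm_num
    have h4 : q * (2 * (Real.exp 4 * r)) ≤ 2 * M := by
      calc (q : ℝ) * (2 * (Real.exp 4 * r)) ≤ q * (2 * (55 * r)) := by gcongr
        _ = 10000 * (q * M) * (M * (3850 / (2048 * n))) := by rw [hr]; field_simp; ring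
        _ ≤ n * (M * (3850 / (2048 * n))) := by gcongr
        _ = M * (3850 / 2048) := by field_simp
        _ ≤ 2 * M := by linarith
    rw [h1, ← Real.exp_nat_mul]
    calc _ ≤ Real.exp (((M + 1 : ℕ) : ℝ) * -4) * Real.exp (2 * M) := by
          gcongr
          exact h2.trans (Real.exp_le_exp.2 h4)
      _ ≤ _ := by
        rw [← Real.exp_add]
        apply Real.exp_le_exp.2
        push_cast
        linarith
  -- Chernoff at `θ = 1 / r`: the product contributes at most `exp (22 / 64 / r)` against `exp (1 -
  -- 1 / r)`. The cubic condition on `M` is exactly `6 M ≤ 1 / r`.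
  have hsecond : Real.exp (1 / r * (r - 1)) * (1 + 22 / (2048 * n * r)) ^ (32 * n) ≤
      Real.exp (-(2 * M)) := by
    have h1 : (1 + 22 / (2048 * n * r)) ^ (32 * n) ≤ Real.exp (22 / 64 * (1 / r)) := by
      calc (1 + 22 / (2048 * n * r)) ^ (32 * n) ≤ Real.exp (22 / (2048 * n * r)) ^ (32 * n) := by
            gcongr
            linarith [Real.add_one_le_exp (22 / (2048 * n * r))]
        _ = _ := by
          rw [← Real.exp_nat_mul]
          congr 1
          push_cast
          field_simp
          norm_num
    have h2 : 6 * M ≤ 1 / r := by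
      rw [hr, one_div_div, le_div_iff₀ (by positivity)]
      nlinarith
    calc _ ≤ Real.exp (1 / r * (r - 1)) * Real.exp (22 / 64 * (1 / r)) := by gcongr
      _ = Real.exp (1 - 42 / 64 * (1 / r)) := by
        rw [← Real.exp_add]
        congr 1
        field_simp
        ring
      _ ≤ _ := by
        apply Real.exp_le_exp.2
        linarith
  have h64 : 64 * n * Real.exp (-(2 * M)) ≤ 1 / 20 := by
    calc 64 * n * Real.exp (-(2 * M)) ≤ 64 * n * (1 / (n : ℝ) ^ 2) := by gcongr
      _ = 64 / n := by field_simp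
      _ ≤ 1 / 20 := by rw [div_le_div_iff₀ (by linarith) (by norm_num)]; linarith
  push_cast
  nlinarith

lemma hasSum_prodSum {ι J κ : Type*} [Fintype ι] [Fintype J] [DecidableEq ι]
    (μ : ι → J → ℝ)    {F : κ → (ι → J) → ℝ} {G : (ι → J) → ℝ} (h : ∀ u, HasSum (fun k => F k u) (G u)) :
    HasSum (fun k => prodSum μ (F k)) (prodSum μ G) :=
  hasSum_sum fun u _ => (h u).mul_left _

/-- There is a function that no algorithm with few samples can, for all distributions, both
accept where it agrees with a halfspace and reject where it is far from all halfspaces. -/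
theorem exists_untestable {n q M : ℕ} (hn : 1280 ≤ n) (hM : 1 ≤ M) (hlog : Real.log n ≤ M)
    (hM3 : 1050000 * M ^ 3 ≤ 1024 * n) (hq : 10000 * (q * M) ≤ n) :
    ∃ f : Cube n → Bool, ∀ acc : PMF (Cube n) → ℝ≥0∞, IsSampleMixture q acc →
      (∀ D, (∃ h ∈ halfspaces n, ∀ x, D x ≠ 0 → h x = f x) → 2 / 3 ≤ (acc D).toReal) →
      ¬ ∀ D, (∀ h ∈ halfspaces n, ENNReal.ofReal (1 / 1024) ≤ distD D f h) →
        (acc D).toReal ≤ 1 / 3 := by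
  classical
  have hn0 : (1280 : ℝ) ≤ n := by exact_mod_cast hn
  have hM0 : (1 : ℝ) ≤ M := by exact_mod_cast hM
  set d := n / 28 with hd
  obtain ⟨t, t₀, f, htinj, hshat, hfar⟩ := exists_hard_function (n := n) (d := d) (by omega)
    (by omega) (by omega)
  refine ⟨f, fun acc hacc hyes hno => ?_⟩
  obtain ⟨κ, A, Φ, hΦ, haccΦ⟩ := hacc
  -- The value `350000` makes the mean number of nonzero weights under `μ`, at most `32 n * 24 /
  -- 350000`, less than `0.123 d`.
  obtain ⟨J, _, x, μ, ν, j₀, hx0, hx1, hxM, hμ, hν, hμ1, hν1, hνj, hμj, hμx, hνx, hmom⟩ :=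
    exists_matching_moments (A := 350000) (by norm_num) hM
  set y : J → ℝ := fun j => x j / (2048 * n) with hy
  have hxn : ∀ j, 0 ≤ x j := fun j => by
    by_cases h : j = j₀
    · rw [h, hx0]
    · linarith [hx1 j h]
  have hyn : ∀ j, 0 ≤ y j := fun j => by have := hxn j; positivity
  have hy0 : y j₀ = 0 := by simp [hy, hx0]
  set r : ℝ := 350000 * (M : ℝ) ^ 2 / (2048 * n) with hr
  have hr0 : 0 < r := by rw [hr]; positivity
  have hyr : ∀ j, y j ≤ r := fun j => by
    simp only [hy, hr]
    exact div_le_div_of_nonneg_right (hxM j) (by positivity)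
  have hexp : ∀ μ : J → ℝ, (∀ j, 0 ≤ μ j) → ∑ j, μ j = 1 → ∑ j, μ j * x j ≤ 11 →
      ∑ j, μ j * Real.exp (1 / r * y j) ≤ 1 + 22 / (2048 * n * r) := by
    intro μ hμ hμ1 hμx
    calc ∑ j, μ j * Real.exp (1 / r * y j) ≤ ∑ j, (μ j + 2 / (2048 * n * r) * (μ j * x j)) := by
          refine Finset.sum_le_sum fun j _ => ?_
          have h1 := exp_le_one_add_two_mul (y := 1 / r * y j)
            (mul_nonneg (by positivity) (hyn j))
            (by rw [one_div, inv_mul_le_iff₀ hr0, mul_one]; exact hyr j)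
          calc _ ≤ μ j * (1 + 2 * (1 / r * y j)) := mul_le_mul_of_nonneg_left h1 (hμ j)
            _ = _ := by simp only [hy]; field_simp
      _ = 1 + 2 / (2048 * n * r) * ∑ j, μ j * x j := by
        rw [Finset.sum_add_distrib, hμ1, Finset.mul_sum]
      _ ≤ 1 + 2 / (2048 * n * r) * 11 := by gcongr
      _ = _ := by ring
  have hmomy : ∀ k ≤ M, ∑ j, (μ j - ν j) * y j ^ k = 0 := fun k hk => by
    have : ∀ j, (μ j - ν j) * y j ^ k = (μ j - ν j) * x j ^ k / (2048 * n) ^ k := fun j => by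
      simp only [hy, div_pow]; ring
    simp only [this]
    rw [← Finset.sum_div, hmom k hk, zero_div]
  let Fk : κ → (Fin (32 * n) → J) → ℝ := fun k u =>
    if ∑ i, y (u i) ≤ 1 then Φ k (pointWeight t t₀ fun i => y (u i)) else 0
  -- If the weights exceed total mass `1` they define no distribution, and the acceptance
  -- probability is replaced by `0`. This is harmless for the upper bound under `ν`; under `μ` it is
  -- paid for by the mean total weight.
  let F : (Fin (32 * n) → J) → ℝ := fun u =>
    if h : ∑ i, y (u i) ≤ 1 then
      (acc (pointPMF t t₀ (fun i => y (u i)) (fun i => hyn _) h)).toReal else 0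
  have hsumF : ∀ u, HasSum (fun k => (A k).toReal * Fk k u) (F u) := fun u => by
    by_cases h : ∑ i, y (u i) ≤ 1
    · simp only [Fk, F, if_pos h, dif_pos h]
      have := IsSampleMixture.hasSum_toReal hΦ haccΦ
        (pointPMF t t₀ (fun i => y (u i)) (fun i => hyn _) h)
      simpa only [pointPMF_toReal] using this
    · simp only [Fk, F, if_neg h, dif_neg h, mul_zero]
      exact hasSum_zero
  have hclose : prodSum (fun _ => μ) F - prodSum (fun _ => ν) F ≤ 1 / 10 := by
    have h1 := (hasSum_prodSum (fun _ => μ) hsumF).sub (hasSum_prodSum (fun _ => ν) hsumF)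
    have h2 : HasSum (fun k => (A k).toReal * (1 / 10)) (1 * (1 / 10)) := by
      refine HasSum.mul_right _ ?_
      have h3 := ENNReal.hasSum_toReal A.tsum_coe_ne_top
      rwa [← ENNReal.tsum_toReal_eq fun k => A.apply_ne_top k, A.tsum_coe,
        ENNReal.toReal_one] at h3
    rw [← one_mul (1 / 10 : ℝ)]
    refine hasSum_le (fun k => ?_) h1 h2
    rw [prodSum_const_mul, prodSum_const_mul, ← mul_sub]
    refine mul_le_mul_of_nonneg_left ?_ ENNReal.toReal_nonneg
    refine (le_abs_self _).trans ((abs_prodSum_samplePoly_sub_le (hΦ k) t t₀ (r := r)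
      (ρ := Real.exp 4 * r) (θ := 1 / r) hyn hyr hr0 ?_ (by positivity) hμ hν hμ1 hν1 hmomy
      (hexp μ hμ hμ1 hμx) (hexp ν hν hν1 hνx)).trans ?_)
    · have : 1 ≤ Real.exp 4 := Real.one_le_exp (by norm_num)
      nlinarith
    · rw [Fintype.card_fin]
      exact hybrid_bound_le hn hM hlog hM3 hq hr
  have hreject : prodSum (fun _ => ν) F ≤ 1 / 3 := by
    have h1 : prodSum (fun _ : Fin (32 * n) => ν) (fun _ => 1 / 3 * 1) = 1 / 3 := by
      rw [prodSum_const_mul, prodSum_one (fun _ => hν1), mul_one]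
    rw [← h1]
    refine Finset.sum_le_sum fun u _ => ?_
    by_cases hu : ∃ i, u i = j₀
    · obtain ⟨i, hi⟩ := hu
      have h0 : ∏ i, ν (u i) = 0 :=
        Finset.prod_eq_zero (Finset.mem_univ i) (by rw [hi, hνj])
      rw [h0, zero_mul, zero_mul]
    · push Not at hu
      refine mul_le_mul_of_nonneg_left ?_ (Finset.prod_nonneg fun i _ => hν _)
      rw [mul_one]
      by_cases h : ∑ i, y (u i) ≤ 1
      · simp only [F, dif_pos h]
        refine hno _ fun g hg => ?_
        refine le_trans (ENNReal.ofReal_le_ofReal ?_) (ofReal_le_distD_pointPMF t₀ _ h htinj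
          (η := 1 / (2048 * n)) fun i => ?_)
        · have h2 : ((2 * n : ℕ) : ℝ) ≤
              (Finset.univ.filter fun i => g (t i) ≠ f (t i)).card := by
            exact_mod_cast (hfar g hg).le
          calc (1 / 1024 : ℝ) = ((2 * n : ℕ) : ℝ) * (1 / (2048 * n)) := by
                push_cast; field_simp; norm_num
            _ ≤ _ := by gcongr
        · exact div_le_div_of_nonneg_right (hx1 _ (hu i)) (by positivity)
      · simp only [F, dif_neg h]
        norm_num
  have hd56 : (n : ℝ) ≤ 56 * d := by
    have : n ≤ 56 * d := by omega
    exact_mod_cast this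
  have hd0 : (0 : ℝ) < d := by linarith
  -- Markov's inequality in pointwise form: `2 / 3 + ∑ g (u i)` is at most `2 / 3` always, and at
  -- most `0` when the total weight exceeds `1` or at least `d` weights are nonzero. It thus lies
  -- below `F`, and its mean under `μ` is at least `2 / 3 - 0.2`, which exceeds `1 / 3 + 1 / 10`.
  let g : J → ℝ := fun j => -(2 / 3) * y j + -(2 / 3) / d * if j = j₀ then 0 else 1
  have hF0 : ∀ u, 0 ≤ F u := fun u => by
    simp only [F]; split_ifs; exacts [ENNReal.toReal_nonneg, le_rfl]
  have haccept : prodSum (fun _ : Fin (32 * n) => μ) (fun u => 2 / 3 * 1 + ∑ i, g (u i)) ≤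
      prodSum (fun _ => μ) F := by
    refine prodSum_mono (fun _ => hμ) fun u => ?_
    set S := Finset.univ.filter fun i => u i ≠ j₀ with hS
    have hsum : ∑ i, g (u i) = -(2 / 3) * ∑ i, y (u i) + -(2 / 3) / d * S.card := by
      simp only [g]
      rw [Finset.sum_add_distrib, ← Finset.mul_sum, ← Finset.mul_sum, hS, Finset.card_filter]
      push_cast
      congr 3
      ext i
      by_cases h : u i = j₀ <;> simp [h]
    have hy' : 0 ≤ ∑ i, y (u i) := Finset.sum_nonneg fun i _ => hyn _
    have hS' : -(2 / 3) / d * (S.card : ℝ) ≤ 0 := by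
      rw [neg_div, neg_mul]
      exact neg_nonpos.2 (by positivity)
    rw [hsum]
    by_cases h : ∑ i, y (u i) ≤ 1
    · by_cases hSd : S.card + 1 ≤ d
      · have h1 : 2 / 3 ≤ F u := by
          simp only [F, dif_pos h]
          refine hyes _ ?_
          obtain ⟨g, hg, hg0, hgS⟩ := hshat S hSd
          refine ⟨g, hg, fun x hx => ?_⟩
          rcases exists_of_pointPMF_ne_zero hx with rfl | ⟨i, hi, rfl⟩
          · exact hg0
          · refine hgS i ?_
            rw [hS, Finset.mem_filter]
            exact ⟨Finset.mem_univ i, fun h => hi (by rw [h, hy0])⟩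
        linarith
      · have h1 : (d : ℝ) ≤ S.card := by exact_mod_cast (by omega : d ≤ S.card)
        have h2 : -(2 / 3) / d * (S.card : ℝ) ≤ -(2 / 3) := by
          rw [neg_div, neg_mul, neg_le_neg_iff, div_mul_eq_mul_div, le_div_iff₀ hd0]
          linarith
        linarith [hF0 u]
    · linarith [hF0 u]
  rw [prodSum_add, prodSum_const_mul, prodSum_one (fun _ => hμ1), prodSum_sum hμ1,
    Fintype.card_fin] at haccept
  have hg : ∑ j, μ j * g j = -(2 / 3) * ((∑ j, μ j * x j) / (2048 * n)) +
      -(2 / 3) / d * (1 - μ j₀) := by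
    have h1 : 1 - μ j₀ = ∑ j, μ j * if j = j₀ then 0 else 1 := by
      have h2 : ∀ j, (μ j * if j = j₀ then 0 else 1) = μ j - if j = j₀ then μ j else 0 := fun j => by
        split_ifs <;> simp
      simp only [h2]
      rw [Finset.sum_sub_distrib, hμ1, Finset.sum_ite_eq' Finset.univ j₀, if_pos (Finset.mem_univ _)]
    rw [h1, Finset.sum_div, Finset.mul_sum, Finset.mul_sum, ← Finset.sum_add_distrib]
    refine Finset.sum_congr rfl fun j _ => ?_
    simp only [g, hy]
    ring
  have hfinal : -(0.2) ≤ ((32 * n : ℕ) : ℝ) * ∑ j, μ j * g j := by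
    rw [hg]
    have h1 : ((32 * n : ℕ) : ℝ) * ((∑ j, μ j * x j) / (2048 * n)) ≤ 11 / 64 := by
      push_cast
      calc 32 * (n : ℝ) * ((∑ j, μ j * x j) / (2048 * n)) = (∑ j, μ j * x j) / 64 := by
            field_simp; ring
        _ ≤ _ := by gcongr
    have h2 : ((32 * n : ℕ) : ℝ) / d * (1 - μ j₀) ≤ 1792 * (24 / 350000) := by
      rw [Nat.cast_mul, Nat.cast_ofNat]
      have h3 : 32 * (n : ℝ) / d ≤ 1792 := by
        rw [div_le_iff₀ hd0]; linarith
      calc _ ≤ 32 * (n : ℝ) / d * (24 / 350000) := by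
            gcongr
            linarith
        _ ≤ _ := by gcongr
    have h3 : ((32 * n : ℕ) : ℝ) * (-(2 / 3) * ((∑ j, μ j * x j) / (2048 * n)) +
        -(2 / 3) / d * (1 - μ j₀)) =
        -(2 / 3) * (((32 * n : ℕ) : ℝ) * ((∑ j, μ j * x j) / (2048 * n))) -
        (2 / 3) * (((32 * n : ℕ) : ℝ) / d * (1 - μ j₀)) := by ring
    rw [h3]
    have h4 : (1792 : ℝ) * (24 / 350000) ≤ 0.123 := by norm_num
    linarith
  linarith

lemma pmf_bool_add (p : PMF Bool) : (p true).toReal + (p false).toReal = 1 := by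
  have := sum_pmf_toReal_eq_one p
  rwa [Fintype.sum_bool] at this

lemma two_thirds_le_toReal {p : PMF Bool} {b : Bool} (h : 2 / 3 ≤ p b) :
    2 / 3 ≤ (p b).toReal := by
  have := ENNReal.toReal_mono (p.apply_ne_top b) h
  simpa using this

lemma toReal_true_le {p : PMF Bool} (h : 2 / 3 ≤ p false) : (p true).toReal ≤ 1 / 3 := by
  linarith [two_thirds_le_toReal h, pmf_bool_add p]

/-- Some function on the cube is far from all halfspaces: parity on two coordinates. -/
lemma exists_far_from_halfspaces {n : ℕ} (hn : 2 ≤ n) :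
    ∃ (D : PMF (Cube n)) (f : Cube n → Bool),
      ∀ h ∈ halfspaces n, ENNReal.ofReal (1 / 1024) ≤ distD D f h := by
  classical
  let i₀ : Fin n := ⟨0, by omega⟩
  let i₁ : Fin n := ⟨1, by omega⟩
  have hi : i₁ ≠ i₀ := by simp [i₀, i₁]
  let p : ℤˣ × ℤˣ → Cube n := fun z i => if i = i₀ then z.1 else if i = i₁ then z.2 else 1
  let S : Finset (Cube n) := Finset.univ.image p
  have hp : ∀ z, p z ∈ S := fun z => Finset.mem_image_of_mem _ (Finset.mem_univ z)
  have hne : S.Nonempty := ⟨_, hp 1⟩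
  have hS : S.card ≤ 4 := Finset.card_image_le.trans (by decide)
  refine ⟨PMF.uniformOfFinset S hne, fun x => decide (x i₀ = x i₁), fun h hh => ?_⟩
  obtain ⟨z, hz⟩ : ∃ z, decide (p z i₀ = p z i₁) ≠ h (p z) := by
    by_contra! hall
    obtain ⟨w₀, w, hw⟩ := hh
    set L : Cube n → ℝ := fun x => w₀ + ∑ i, w i * (((x i : ℤˣ) : ℤ) : ℝ) with hL
    have hpz : ∀ z : ℤˣ × ℤˣ, z.1 = z.2 ↔ 0 ≤ L (p z) := fun z => by
      rw [hL, ← hw, ← hall z, decide_eq_true_eq]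
      simp [p, hi]
    -- An affine form has equal sums over the two diagonals of a square, while agreement with the
    -- labeling would make one sum nonnegative and the other negative.
    have hlin : L (p (1, 1)) + L (p (-1, -1)) = L (p (1, -1)) + L (p (-1, 1)) := by
      have h1 : ∀ i, w i * (((p (1, 1) i : ℤˣ) : ℤ) : ℝ) + w i * (((p (-1, -1) i : ℤˣ) : ℤ) : ℝ) =
          w i * (((p (1, -1) i : ℤˣ) : ℤ) : ℝ) + w i * (((p (-1, 1) i : ℤˣ) : ℤ) : ℝ) := fun i => by
        simp only [p]
        split_ifs <;> push_cast <;> ring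
      have h2 := Finset.sum_congr (rfl : Finset.univ = Finset.univ) fun i _ => h1 i
      rw [Finset.sum_add_distrib, Finset.sum_add_distrib] at h2
      simp only [hL]
      linarith
    have h1 := (hpz (1, 1)).1 rfl
    have h2 := (hpz (-1, -1)).1 rfl
    have h3 : ¬ 0 ≤ L (p (1, -1)) := fun h => absurd ((hpz (1, -1)).2 h) (by decide)
    have h4 : ¬ 0 ≤ L (p (-1, 1)) := fun h => absurd ((hpz (-1, 1)).2 h) (by decide)
    linarith
  have hle : (PMF.uniformOfFinset S hne) (p z) ≤
      distD (PMF.uniformOfFinset S hne) (fun x => decide (x i₀ = x i₁)) h := by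
    have h1 := PMF.toOuterMeasure_apply_finset (PMF.uniformOfFinset S hne) {p z}
    rw [Finset.sum_singleton] at h1
    rw [← h1]
    refine MeasureTheory.measure_mono ?_
    simpa using hz
  refine le_trans ?_ hle
  rw [PMF.uniformOfFinset_apply_of_mem _ (hp z)]
  calc ENNReal.ofReal (1 / 1024) ≤ ENNReal.ofReal (4 : ℝ)⁻¹ :=
        ENNReal.ofReal_le_ofReal (by norm_num)
    _ = (4 : ℝ≥0∞)⁻¹ := by rw [ENNReal.ofReal_inv_of_pos (by norm_num), ENNReal.ofReal_ofNat]
    _ ≤ _ := by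
      rw [ENNReal.inv_le_inv]
      exact_mod_cast hS

lemma const_true_mem_halfspaces (n : ℕ) : (fun _ => true) ∈ halfspaces n :=
  ⟨0, fun _ => 0, fun x => by simp⟩

lemma distToClass_eq_zero_of_agree {X : Type*} {D : PMF X} {f : X → Bool} {H : Set (X → Bool)}
    (h : ∃ h ∈ H, ∀ x, D x ≠ 0 → h x = f x) : distToClass D f H = 0 := by
  obtain ⟨h, hh, hD⟩ := h
  refine le_antisymm ((iInf₂_le h hh).trans ?_) zero_le
  rw [distD, (PMF.toOuterMeasure_apply_eq_zero_iff D _).2]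
  rw [Set.disjoint_left]
  exact fun x hx hne => hne (hD x ((PMF.mem_support_iff D x).1 hx)).symm

/-- A sample tester promises acceptance only for members of the class. Since samples never leave the
support of `D`, the promise extends to functions that agree with a member there. -/
lemma SampleAlg.run_congr {X : Type*} [Fintype X] {m : ℕ} (A : SampleAlg X m) {f h : X → Bool}
    {D : PMF X} (hD : ∀ x, D x ≠ 0 → h x = f x) : A.run f D = A.run h D := by
  ext b
  rw [SampleAlg.run, SampleAlg.run, PMF.bind_apply, PMF.bind_apply]
  refine tsum_congr fun s => ?_
  by_cases hs : iid D m s = 0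
  · rw [hs, zero_mul, zero_mul]
  · have h1 : ∀ i, D (s i) ≠ 0 := fun i h0 =>
      hs (by rw [iid, PMF.ofFintype_apply]; exact Finset.prod_eq_zero (Finset.mem_univ i) h0)
    have h2 : (fun i => (s i, f (s i))) = fun i => (s i, h (s i)) := by
      ext i
      · rfl
      · rw [hD _ (h1 i)]
    rw [h2]

lemma ofReal_lt_distToClass {X : Type*} {D : PMF X} {f : X → Bool} {H : Set (X → Bool)} {ε : ℝ}
    (hε : ε < 1 / 1024) (h : ∀ h ∈ H, ENNReal.ofReal (1 / 1024) ≤ distD D f h) :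
    ENNReal.ofReal ε < distToClass D f H :=
  ((ENNReal.ofReal_lt_ofReal_iff (by norm_num)).2 hε).trans_le (le_iInf₂ h)

/-- What a tester with acceptance probability `acc f D` on input `f`, `D` has to satisfy in
order to be refuted. -/
def IsWeakTester {X : Type} [Fintype X] (q : ℕ) (H : Set (X → Bool))
    (acc : (X → Bool) → PMF X → ℝ≥0∞) : Prop :=
  (∀ f, IsSampleMixture q (acc f)) ∧
  (∀ f D, (∃ h ∈ H, ∀ x, D x ≠ 0 → h x = f x) → 2 / 3 ≤ (acc f D).toReal) ∧
  (∀ f D, (∀ h ∈ H, ENNReal.ofReal (1 / 1024) ≤ distD D f h) → (acc f D).toReal ≤ 1 / 3) ∧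
  (q = 0 → ∀ f g D, acc f D = acc g D)

lemma IsSampleTester.isWeakTester {X : Type} [Fintype X] {ε : ℝ} (hε : ε < 1 / 1024)
    {H : Set (X → Bool)} {m : ℕ} {A : SampleAlg X m} (hA : IsSampleTester ε H A) :
    IsWeakTester m H fun f D => A.run f D true := by
  refine ⟨A.isSampleMixture, fun f D hf => ?_, fun f D hf => ?_, fun hm f g D => ?_⟩
  · obtain ⟨h, hh, hD⟩ := hf
    simp only [A.run_congr hD]
    exact two_thirds_le_toReal ((hA D h).1 hh)
  · exact toReal_true_le ((hA D f).2 (ofReal_lt_distToClass hε hf))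
  · subst hm
    have h : ∀ s : Fin 0 → X, (fun i => (s i, f (s i))) = fun i => (s i, g (s i)) := fun s =>
      Subsingleton.elim _ _
    simp only [SampleAlg.run, h]

lemma IsTolerantTester.isWeakTester {X : Type} [Fintype X] {ε : ℝ} (hε : ε < 1 / 1024)
    {H : Set (X → Bool)} {q : ℕ} {A : AdaptiveAlg X q} (hA : IsTolerantTester 0 ε H A) :
    IsWeakTester q H fun f D => AdaptiveAlg.run A f D true := by
  refine ⟨AdaptiveAlg.isSampleMixture A, fun f D hf => ?_, fun f D hf => ?_, fun hq f g D => ?_⟩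
  · refine two_thirds_le_toReal ((hA D f).1 ?_)
    rw [distToClass_eq_zero_of_agree hf]
    exact zero_le
  · exact toReal_true_le ((hA D f).2 (ofReal_lt_distToClass hε hf).le)
  · subst hq
    have h : ∀ T : AdaptiveTree X 0, T.run f D = T.run g D := fun T => by
      cases T
      simp only [AdaptiveTree.run]
    simp only [AdaptiveAlg.run, h]

/-- An algorithm that sees no values treats a constant function and a far function alike. This bound
is what settles small `n`, where the asymptotic argument does not apply. -/
lemma IsWeakTester.one_le {n q : ℕ} (hn : 2 ≤ n) {acc : (Cube n → Bool) → PMF (Cube n) → ℝ≥0∞}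
    (h : IsWeakTester q (halfspaces n) acc) : 1 ≤ q := by
  by_contra! hq
  obtain ⟨D, f, hf⟩ := exists_far_from_halfspaces hn
  have h1 := h.2.1 (fun _ => true) D ⟨_, const_true_mem_halfspaces n, fun _ _ => rfl⟩
  rw [h.2.2.2 (by omega) _ f] at h1
  linarith [h.2.2.1 f D hf]

lemma exists_sample_bound_const : ∃ c : ℝ, 0 < c ∧ ∀ n q : ℕ, 2 ≤ n → 1 ≤ q →
    (q : ℝ) < c * (n / Real.log n) → 1280 ≤ n ∧ ∃ M : ℕ, 1 ≤ M ∧ Real.log n ≤ M ∧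
      1050000 * M ^ 3 ≤ 1024 * n ∧ 10000 * (q * M) ≤ n := by
  have hlim : ∀ᶠ x : ℝ in Filter.atTop, Real.log x ^ 3 ≤ 1 / 10000000 * x := by
    have := (Real.isLittleO_pow_log_id_atTop (n := 3)).bound
      (show (0 : ℝ) < 1 / 10000000 by norm_num)
    filter_upwards [this, Filter.eventually_ge_atTop 1] with x hx hx1
    rw [Real.norm_eq_abs, id, Real.norm_eq_abs, abs_of_nonneg (by linarith : (0 : ℝ) ≤ x)] at hx
    exact (le_abs_self _).trans hx
  obtain ⟨n₁, hn₁⟩ := Filter.eventually_atTop.1 (tendsto_natCast_atTop_atTop.eventually hlim)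
  set n₀ := max n₁ 1280 with hn₀
  have hn₀' : (0 : ℝ) < n₀ := by
    have : 0 < n₀ := by omega
    exact_mod_cast this
  have hlog2 : 0 < Real.log 2 := Real.log_pos (by norm_num)
  -- The second term makes the bound at most `1` for `n` below `n₀`, contradicting `1 ≤ q`. The
  -- first turns `q < c n / log n` into `10000 q M ≤ n` for `M = ⌈log n⌉ ≤ 2 log n`.
  refine ⟨min (1 / 20000) (Real.log 2 / n₀), by positivity, fun n q hn hq hlt => ?_⟩
  have hn2 : (2 : ℝ) ≤ n := by exact_mod_cast hn
  have hq1 : (1 : ℝ) ≤ q := by exact_mod_cast hq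
  have hlogn : Real.log 2 ≤ Real.log n := Real.log_le_log (by norm_num) hn2
  have hlogn0 : 0 < Real.log n := hlog2.trans_le hlogn
  have hge : n₀ ≤ n := by
    by_contra! hlt'
    have hlt'' : (n : ℝ) ≤ n₀ := by exact_mod_cast hlt'.le
    have h1 : min (1 / 20000) (Real.log 2 / n₀) * (n / Real.log n) ≤ 1 := by
      calc _ ≤ Real.log 2 / n₀ * (n / Real.log n) := by gcongr; exact min_le_right _ _
        _ ≤ Real.log 2 / n₀ * (n₀ / Real.log 2) := by gcongr
        _ = 1 := by field_simp
    linarith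
  have hn1280 : 1280 ≤ n := by omega
  have hlog1 : 1 ≤ Real.log n := by
    rw [Real.le_log_iff_exp_le (by linarith)]
    have h1 : (1280 : ℝ) ≤ n := by exact_mod_cast hn1280
    linarith [Real.exp_one_lt_d9]
  have hM2 : ((⌈Real.log n⌉₊ : ℕ) : ℝ) ≤ 2 * Real.log n := by
    linarith [(Nat.ceil_lt_add_one hlogn0.le)]
  refine ⟨hn1280, ⌈Real.log n⌉₊, Nat.one_le_ceil_iff.2 hlogn0, Nat.le_ceil _, ?_, ?_⟩
  · have h1 := hn₁ n (by omega)
    have h2 : ((⌈Real.log n⌉₊ : ℕ) : ℝ) ^ 3 ≤ (2 * Real.log n) ^ 3 := by gcongr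
    have h3 : 1050000 * ((⌈Real.log n⌉₊ : ℕ) : ℝ) ^ 3 ≤ 1024 * n := by
      rw [mul_pow] at h2
      linarith
    exact_mod_cast h3
  · have h1 : (q : ℝ) ≤ 1 / 20000 * (n / Real.log n) := by
      refine hlt.le.trans ?_
      gcongr
      exact min_le_left _ _
    have h3 : 10000 * ((q : ℝ) * (⌈Real.log n⌉₊ : ℕ)) ≤ n := by
      calc _ ≤ 10000 * (1 / 20000 * (n / Real.log n) * (2 * Real.log n)) := by gcongr
        _ = n := by field_simp; norm_num
    exact_mod_cast h3

lemma ofReal_le_coe_iInf {P : ℕ → Prop} {x : ℝ} (h : ∀ m, P m → x ≤ m) :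
    ENNReal.ofReal x ≤ ((⨅ (m : ℕ) (_ : P m), (m : ℕ∞) : ℕ∞) : ℝ≥0∞) := by
  have h1 : ((⌈x⌉₊ : ℕ) : ℕ∞) ≤ ⨅ (m : ℕ) (_ : P m), (m : ℕ∞) :=
    le_iInf₂ fun m hm => by exact_mod_cast Nat.ceil_le.2 (h m hm)
  calc ENNReal.ofReal x ≤ ENNReal.ofReal (⌈x⌉₊ : ℕ) := ENNReal.ofReal_le_ofReal (Nat.le_ceil x)
    _ = (((⌈x⌉₊ : ℕ) : ℕ∞) : ℝ≥0∞) := by simp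
    _ ≤ _ := by exact_mod_cast h1

end PropertyTesting

theorem mainTheorem5 :
    ∃ ε₀ : ℝ, 0 < ε₀ ∧ ∃ c : ℝ, 0 < c ∧
      ∀ ε : ℝ, 0 < ε → ε < ε₀ → ∀ n : ℕ, 2 ≤ n →
        ENNReal.ofReal (c * (n / Real.log n)) ≤
            (PropertyTesting.mTest ε (PropertyTesting.halfspaces n) : ENNReal) ∧
        ENNReal.ofReal (c * (n / Real.log n)) ≤
            (PropertyTesting.qTol 0 ε (PropertyTesting.halfspaces n) : ENNReal) := by
  obtain ⟨c, hc, hbound⟩ := PropertyTesting.exists_sample_bound_const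
  refine ⟨1 / 1024, by norm_num, c, hc, fun ε _ hε n hn => ?_⟩
  have main : ∀ q acc, PropertyTesting.IsWeakTester q (PropertyTesting.halfspaces n) acc →
      c * (n / Real.log n) ≤ q := fun q acc h => by
    by_contra! hlt
    obtain ⟨hn', M, hM, hlog, hM3, hq⟩ := hbound n q hn (h.one_le hn) hlt
    obtain ⟨f, hf⟩ := PropertyTesting.exists_untestable hn' hM hlog hM3 hq
    exact hf (acc f) (h.1 f) (h.2.1 f) (h.2.2.1 f)
  exact ⟨PropertyTesting.ofReal_le_coe_iInf fun m ⟨_, hA⟩ => main m _ (hA.isWeakTester hε),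
    PropertyTesting.ofReal_le_coe_iInf fun q ⟨_, hA⟩ => main q _ (hA.isWeakTester hε)⟩
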